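/- **Conventions.** A graph has vertices $V$, edges $E$ and maps $\iota,\tau:E\to V$; morphisms preserve $\iota,\tau$, and a morphism is an immersion if it identifies no two distinct edges with the same initial vertex or with the same terminal vertex. A *2-complex* $X$ consists of a graph $G_X$ (its 1-skeleton), a disjoint union of finite cycles $S_X$ (the boundaries of its faces), and an immersion $w_X:S_X\to G_X$; it is finite if $G_X$ and $S_X$ are finite. A *morphism* $f:Y\to X$ consists of a morphism $G_Y\to G_X$ and an immersion (hence covering map onto components) $S_Y\to S_X$ commuting with $w_Y,w_X$. Its *degree* $\deg(f)$ is the sum, over the components $C$ of $S_Y$, of the degree of the covering map from $C$ to its image component, and $\tau(Y)=\tau(f):=\deg(f)+\chi(G_Y)$. Performing all Stallings folds of $G_Y\to G_X$ yields $G_Y\to G_{\bar Y}\to G_X$ with $G_{\bar Y}\to G_X$ an immersion; let $S_{\bar Y}$ be the image of $S_Y$ in $G_{\bar Y}\times_{G_X}S_X$. The morphism $f$ is *face-essential* if $S_Y\to S_{\bar Y}$ is an isomorphism (folding $f$ identifies no faces). The *Whitehead graph* of a vertex $v$ of $Y$ has as vertices the half-edges of $G_Y$ at $v$ (a loop gives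 two), and one edge for each $u\in w_Y^{-1}(v)$, joining the images of the two half-edges of $S_Y$ at $u$. A finite 2-complex $Y$ is *visibly irreducible* if no component of $Y$ is a point, no vertex of $G_Y$ has valence 1, no edge $e$ of $G_Y$ has $\#w_Y^{-1}(e)=1$, no Whitehead graph of a vertex of $Y$ is disconnected, and none has a cut vertex (a vertex whose removal disconnects it). **Theorem.** Let $X$ be a finite 2-complex that admits at least one face-essential map from a non-empty, finite, visibly irreducible 2-complex. Then there are a non-empty, finite, visibly irreducible 2-complex $Y_{\max}$ and a face-essential map $f_{\max}:Y_{\max}\to X$ such that $$\frac{\tau(Y_{\max})}{\deg(f_{\max})}\ \geq\ \frac{\tau(Y)}{\deg(f)}$$ for all face-essential maps $f:Y\to X$ with $Y$ non-empty, finite and visibly irreducible (all degrees occurring here are positive, so the quotients are defined). In particular the supremum of $\tau(Y)/\deg(f)$ over all such maps is attained. -/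

import Mathlib

universe u

/-- A graph, with vertex set `V`, edge set `E`, and every edge `e` running from `ι e` to `τ e`.
Loops and multiple edges are allowed. -/
structure MGraph where
  V : Type u
  E : Type u
  ι : E → V
  τ : E → V

namespace MGraph

/-- The half-edges of `G`: `Sum.inl e` is the initial half of `e` and `Sum.inr e` its terminal half
(so a loop has two distinct half-edges at its vertex). -/
abbrev Half (G : MGraph.{u}) : Type u := G.E ⊕ G.E

/-- The vertex at which a half-edge is incident. -/
def base (G : MGraph.{u}) : G.Half → G.V := Sum.elim G.ι G.τ

/-- The half-edges at `v`, i.e. the edge set `ι⁻¹(v) ⊔ τ⁻¹(v)` of the regular neighbourhood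
(asterisk) of `v`. -/
abbrev Star (G : MGraph.{u}) (v : G.V) : Type u := {h : G.Half // G.base h = v}

/-- The valence of a vertex (loops count twice). -/
noncomputable def valence (G : MGraph.{u}) (v : G.V) : ℕ := Nat.card (G.Star v)

/-- Two vertices lie in the same connected component. -/
def connSetoid (G : MGraph.{u}) : Setoid G.V :=
  Relation.EqvGen.setoid (fun u v => ∃ e : G.E, G.ι e = u ∧ G.τ e = v)

/-- The set `π₀(G)` of connected components. -/
abbrev Comp (G : MGraph.{u}) : Type u := Quotient G.connSetoid

/-- `χ(G) = #V - #E`, for a finite graph. -/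
noncomputable def eulerChar (G : MGraph.{u}) : ℤ := (Nat.card G.V : ℤ) - (Nat.card G.E : ℤ)

/-- Every connected component of `G` is a cycle: a finite connected graph in which every vertex has
exactly two incident (half-)edges. -/
structure IsUnionOfCycles (G : MGraph.{u}) : Prop where
  valence_eq_two : ∀ v : G.V, G.valence v = 2
  finite_comp : ∀ v : G.V, {v' : G.V | G.connSetoid v v'}.Finite

/-- Morphisms of graphs. -/
@[ext]
structure Hom (G H : MGraph.{u}) where
  onV : G.V → H.V
  onE : G.E → H.E
  map_ι : ∀ e, H.ι (onE e) = onV (G.ι e)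
  map_τ : ∀ e, H.τ (onE e) = onV (G.τ e)

namespace Hom

variable {G H K : MGraph.{u}}

/-- The map induced on half-edges. -/
def onHalf (f : Hom G H) : G.Half → H.Half := Sum.map f.onE f.onE

def comp (g : Hom H K) (f : Hom G H) : Hom G K where
  onV := g.onV ∘ f.onV
  onE := g.onE ∘ f.onE
  map_ι e := by simp [g.map_ι, f.map_ι]
  map_τ e := by simp [g.map_τ, f.map_τ]

/-- An immersion of graphs. -/
def IsImmersion (f : Hom G H) : Prop :=
  ∀ e e' : G.E, (G.ι e = G.ι e' ∨ G.τ e = G.τ e') → f.onE e = f.onE e' → e = e'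

/-- An isomorphism of graphs. -/
def IsIso (f : Hom G H) : Prop := Function.Bijective f.onV ∧ Function.Bijective f.onE

theorem base_onHalf (f : Hom G H) (h : G.Half) : H.base (f.onHalf h) = f.onV (G.base h) := by
  rcases h with e | e
  · exact f.map_ι e
  · exact f.map_τ e

theorem IsImmersion.half_inj {f : Hom G H} (hf : f.IsImmersion) {h h' : G.Half}
    (hb : G.base h = G.base h') (hh : f.onHalf h = f.onHalf h') : h = h' := by
  rcases h with e | e <;> rcases h' with e' | e' <;> simp [onHalf] at hh
  · exact congrArg _ (hf e e' (Or.inl hb) hh)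
  · exact congrArg _ (hf e e' (Or.inr hb) hh)

/-! ### Folding a morphism of graphs -/

mutual
/-- The vertices identified when `f` is folded as far as possible. -/
inductive FoldV (f : Hom G H) : G.V → G.V → Prop
  | refl (v : G.V) : FoldV f v v
  | symm {v v' : G.V} : FoldV f v v' → FoldV f v' v
  | trans {v v' v'' : G.V} : FoldV f v v' → FoldV f v' v'' → FoldV f v v''
  | ι {e e' : G.E} : FoldE f e e' → FoldV f (G.ι e) (G.ι e')
  | τ {e e' : G.E} : FoldE f e e' → FoldV f (G.τ e) (G.τ e')
/-- The edges identified when `f` is folded as far as possible: two edges with the same image which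
have the same initial vertex, or the same terminal vertex, after earlier folds are folded. -/
inductive FoldE (f : Hom G H) : G.E → G.E → Prop
  | refl (e : G.E) : FoldE f e e
  | symm {e e' : G.E} : FoldE f e e' → FoldE f e' e
  | trans {e e' e'' : G.E} : FoldE f e e' → FoldE f e' e'' → FoldE f e e''
  | ι {e e' : G.E} : FoldV f (G.ι e) (G.ι e') → f.onE e = f.onE e' → FoldE f e e'
  | τ {e e' : G.E} : FoldV f (G.τ e) (G.τ e') → f.onE e = f.onE e' → FoldE f e e'
end

def foldVSetoid (f : Hom G H) : Setoid G.V := ⟨FoldV f, .refl, .symm, .trans⟩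

def foldESetoid (f : Hom G H) : Setoid G.E := ⟨FoldE f, .refl, .symm, .trans⟩

theorem FoldE.onE_eq {f : Hom G H} : ∀ {e e' : G.E}, FoldE f e e' → f.onE e = f.onE e'
  | _, _, .refl _ => rfl
  | _, _, .symm h => (FoldE.onE_eq h).symm
  | _, _, .trans h h' => (FoldE.onE_eq h).trans (FoldE.onE_eq h')
  | _, _, .ι _ h => h
  | _, _, .τ _ h => h

theorem FoldV.onV_eq {f : Hom G H} : ∀ {v v' : G.V}, FoldV f v v' → f.onV v = f.onV v'
  | _, _, .refl _ => rfl
  | _, _, .symm h => (FoldV.onV_eq h).symm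
  | _, _, .trans h h' => (FoldV.onV_eq h).trans (FoldV.onV_eq h')
  | _, _, .ι h => by rw [← f.map_ι, ← f.map_ι, FoldE.onE_eq h]
  | _, _, .τ h => by rw [← f.map_τ, ← f.map_τ, FoldE.onE_eq h]

/-- The folded graph of `f : G → H`: the quotient of `G` obtained by performing all Stallings
folds over `H`. -/
def folded (f : Hom G H) : MGraph.{u} where
  V := Quotient f.foldVSetoid
  E := Quotient f.foldESetoid
  ι := Quotient.map G.ι (fun _ _ h => FoldV.ι h)
  τ := Quotient.map G.τ (fun _ _ h => FoldV.τ h)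

/-- The composition of folds `G → folded f`. -/
def toFolded (f : Hom G H) : Hom G f.folded where
  onV := Quotient.mk _
  onE := Quotient.mk _
  map_ι _ := rfl
  map_τ _ := rfl

/-- The induced map `folded f → H`. -/
def ofFolded (f : Hom G H) : Hom f.folded H where
  onV := Quotient.lift f.onV (fun _ _ h => FoldV.onV_eq h)
  onE := Quotient.lift f.onE (fun _ _ h => FoldE.onE_eq h)
  map_ι := by rintro ⟨e⟩; exact f.map_ι e
  map_τ := by rintro ⟨e⟩; exact f.map_τ e

theorem ofFolded_isImmersion (f : Hom G H) : f.ofFolded.IsImmersion := by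
  rintro ⟨e⟩ ⟨e'⟩ h he
  rcases h with h | h
  · exact Quotient.sound (FoldE.ι (Quotient.exact h) he)
  · exact Quotient.sound (FoldE.τ (Quotient.exact h) he)

/-! ### Fiber products and images -/

/-- The fiber product of two morphisms of graphs. -/
def fiberProd (f : Hom G K) (g : Hom H K) : MGraph.{u} where
  V := {p : G.V × H.V // f.onV p.1 = g.onV p.2}
  E := {p : G.E × H.E // f.onE p.1 = g.onE p.2}
  ι p := ⟨(G.ι p.1.1, H.ι p.1.2), by rw [← f.map_ι, ← g.map_ι, p.2]⟩
  τ p := ⟨(G.τ p.1.1, H.τ p.1.2), by rw [← f.map_τ, ← g.map_τ, p.2]⟩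

/-- The image of a morphism of graphs, as a graph. -/
def image (f : Hom G H) : MGraph.{u} where
  V := Set.range f.onV
  E := Set.range f.onE
  ι e := ⟨H.ι e.1, by obtain ⟨e', h⟩ := e.2; exact ⟨G.ι e', by rw [← h, f.map_ι]⟩⟩
  τ e := ⟨H.τ e.1, by obtain ⟨e', h⟩ := e.2; exact ⟨G.τ e', by rw [← h, f.map_τ]⟩⟩

/-- The corestriction of a morphism to its image. -/
def toImage (f : Hom G H) : Hom G f.image where
  onV v := ⟨f.onV v, v, rfl⟩
  onE e := ⟨f.onE e, e, rfl⟩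
  map_ι e := Subtype.ext (f.map_ι e)
  map_τ e := Subtype.ext (f.map_τ e)

/-- If `p` is onto and `q` and `q ∘ p` are immersions, where the source of `p` and the target of `q`
are unions of cycles, then so is the graph in the middle. -/
theorem isUnionOfCycles_of_comp (p : Hom G H) (q : Hom H K)
    (hp : Function.Surjective p.onV) (hq : q.IsImmersion) (hqp : (q.comp p).IsImmersion)
    (hG : G.IsUnionOfCycles) (hK : K.IsUnionOfCycles) : H.IsUnionOfCycles := by
  have hpi : p.IsImmersion := fun e e' h he => hqp e e' h (congrArg q.onE he)
  let s : ∀ a : G.V, G.Star a → H.Star (p.onV a) := fun a h =>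
    ⟨p.onHalf h.1, by rw [base_onHalf, h.2]⟩
  let t : ∀ b : H.V, H.Star b → K.Star (q.onV b) := fun b h =>
    ⟨q.onHalf h.1, by rw [base_onHalf, h.2]⟩
  have hs : ∀ a, Function.Injective (s a) := fun a h h' e =>
    Subtype.ext (hpi.half_inj (h.2.trans h'.2.symm) (congrArg Subtype.val e))
  have ht : ∀ b, Function.Injective (t b) := fun b h h' e =>
    Subtype.ext (hq.half_inj (h.2.trans h'.2.symm) (congrArg Subtype.val e))
  have finK : ∀ c, Finite (K.Star c) := fun c =>
    Nat.finite_of_card_ne_zero (by have := hK.valence_eq_two c; unfold valence at this; omega)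
  have finH : ∀ b, Finite (H.Star b) := fun b =>
    have := finK (q.onV b); Finite.of_injective _ (ht b)
  have hval : ∀ b, H.valence b = 2 := by
    intro b
    obtain ⟨a, rfl⟩ := hp b
    have := finK (q.onV (p.onV a))
    have := finH (p.onV a)
    have h1 := Nat.card_le_card_of_injective _ (hs a)
    have h2 := Nat.card_le_card_of_injective _ (ht (p.onV a))
    have h3 := hG.valence_eq_two a
    have h4 := hK.valence_eq_two (q.onV (p.onV a))
    unfold valence at *
    omega
  refine ⟨hval, fun b => ?_⟩
  obtain ⟨a, rfl⟩ := hp b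
  have hsurj : ∀ a, Function.Surjective (s a) := by
    intro a
    have := finH (p.onV a)
    have h1 : Nat.card (G.Star a) = Nat.card (H.Star (p.onV a)) :=
      (hG.valence_eq_two a).trans (hval (p.onV a)).symm
    exact ((Nat.bijective_iff_injective_and_card (s a)).2 ⟨hs a, h1⟩).2
  refine ((hG.finite_comp a).image p.onV).subset ?_
  have key : ∀ b b', H.connSetoid b b' →
      (b ∈ p.onV '' {a' | G.connSetoid a a'} ↔ b' ∈ p.onV '' {a' | G.connSetoid a a'}) := by
    intro b b' h
    change Relation.EqvGen _ b b' at h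
    induction h with
    | rel b b' h =>
      obtain ⟨e, rfl, rfl⟩ := h
      constructor
      · rintro ⟨a', ha', he⟩
        obtain ⟨⟨x, hx⟩, hh⟩ := hsurj a' ⟨Sum.inl e, he.symm⟩
        have hh := congrArg Subtype.val hh
        rcases x with x | x <;> simp [s, onHalf] at hh
        subst hh
        refine ⟨G.τ x, ?_, (p.map_τ x).symm⟩
        exact Relation.EqvGen.trans _ _ _ ha' (Relation.EqvGen.rel _ _ ⟨x, hx, rfl⟩)
      · rintro ⟨a', ha', he⟩
        obtain ⟨⟨x, hx⟩, hh⟩ := hsurj a' ⟨Sum.inr e, he.symm⟩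
        have hh := congrArg Subtype.val hh
        rcases x with x | x <;> simp [s, onHalf] at hh
        subst hh
        refine ⟨G.ι x, ?_, (p.map_ι x).symm⟩
        exact Relation.EqvGen.trans _ _ _ ha'
          (Relation.EqvGen.symm _ _ (Relation.EqvGen.rel _ _ ⟨x, rfl, hx⟩))
    | refl => exact Iff.rfl
    | symm _ _ _ ih => exact ih.symm
    | trans _ _ _ _ _ ih ih' => exact ih.trans ih'
  intro b' hb'
  exact (key _ _ hb').1 ⟨a, Relation.EqvGen.refl a, rfl⟩

end Hom

end MGraph

/-- A 2-complex: a graph `G` (the 1-skeleton), a disjoint union of cycles `S` (the boundaries of the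
faces) and an immersion `w : S → G` (the attaching map). -/
structure TwoComplex where
  G : MGraph.{u}
  S : MGraph.{u}
  w : MGraph.Hom S G
  cycles : S.IsUnionOfCycles
  w_immersion : w.IsImmersion

namespace TwoComplex

/-- A complex with finitely many vertices, edges and faces. -/
structure IsFinite (X : TwoComplex.{u}) : Prop where
  finite_V : Finite X.G.V
  finite_E : Finite X.G.E
  finite_SV : Finite X.S.V
  finite_SE : Finite X.S.E

/-- The Whitehead graph (link) of a vertex `v`: its vertices are the edges of the regular
neighbourhood `N(v)`, and every passage of a face through `v` joins the two half-edges along which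
it passes. Up to homotopy it is `N(v)` with `v` removed. Only connectivity matters below, so
multiple edges are not recorded. -/
def whitehead (X : TwoComplex.{u}) (v : X.G.V) : SimpleGraph (X.G.Star v) where
  Adj a b := a ≠ b ∧ ∃ s t : X.S.Half, s ≠ t ∧ X.S.base s = X.S.base t ∧
    X.w.onHalf s = a.1 ∧ X.w.onHalf t = b.1
  symm := ⟨by
    rintro a b ⟨hab, s, t, hst, hb, hs, ht⟩
    exact ⟨hab.symm, t, s, hst.symm, hb.symm, ht, hs⟩⟩
  loopless := ⟨fun _ h => h.1 rfl⟩

/-- Visible reducibility. -/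
def VisiblyReducible (X : TwoComplex.{u}) : Prop :=
  -- some component is a point
  (∃ v : X.G.V, IsEmpty (X.G.Star v)) ∨
  -- some vertex has valence 1
  (∃ v : X.G.V, X.G.valence v = 1) ∨
  -- some edge is a free face
  (∃ e : X.G.E, ∃! ε : X.S.E, X.w.onE ε = e) ∨
  -- some vertex `v` separates its regular neighbourhood
  (∃ v : X.G.V, ¬ (X.whitehead v).Preconnected)

/-- Some vertex `v` has an incident edge `a` in `N(v)` such that `v ∪ a` separates `N(v)`,
i.e. `a` is a cut vertex of the Whitehead graph. -/
def HasCutEdge (X : TwoComplex.{u}) : Prop :=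
  ∃ (v : X.G.V) (a : X.G.Star v), ¬ ((X.whitehead v).induce {b | b ≠ a}).Preconnected

/-- Visible irreducibility. -/
def VisiblyIrreducible (X : TwoComplex.{u}) : Prop := ¬ X.VisiblyReducible ∧ ¬ X.HasCutEdge

/-- A morphism of 2-complexes: morphisms of the 1-skeleta and of the face boundaries, compatible
with the attaching maps, where the map of face boundaries is an immersion (hence a covering map). -/
structure Hom (Y X : TwoComplex.{u}) where
  onG : MGraph.Hom Y.G X.G
  onS : MGraph.Hom Y.S X.S
  comm : X.w.comp onS = onG.comp Y.w
  onS_immersion : onS.IsImmersion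

namespace Hom

variable {Y X : TwoComplex.{u}}

/-- The degree with which `f` winds the face `C` around its image: the number of points of `C` in
the fiber through a point of `C`, for the covering map from `C` to its image component. -/
noncomputable def degAt (f : Hom Y X) (C : Y.S.Comp) : ℕ :=
  Nat.card {y : Y.S.V // (Quotient.mk _ y : Y.S.Comp) = C ∧ f.onS.onV y = f.onS.onV C.out}

/-- The degree of `f`: the sum over all faces `C` of `Y` of the degree of `f` on `C`. -/
noncomputable def deg (f : Hom Y X) : ℕ := ∑ᶠ C : Y.S.Comp, f.degAt C

/-- The total curvature `τ(Y) = deg(f) + χ(Y⁽¹⁾)`. -/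
noncomputable def totalCurvature (f : Hom Y X) : ℤ := (f.deg : ℤ) + Y.G.eulerChar

/-- A face-equivalence: a morphism that is an isomorphism on the face boundaries. -/
def IsFaceEquivalence (f : Hom Y X) : Prop := f.onS.IsIso

theorem comm_V (f : Hom Y X) (u : Y.S.V) :
    X.w.onV (f.onS.onV u) = f.onG.onV (Y.w.onV u) :=
  congrFun (congrArg MGraph.Hom.onV f.comm) u

theorem comm_E (f : Hom Y X) (e : Y.S.E) :
    X.w.onE (f.onS.onE e) = f.onG.onE (Y.w.onE e) :=
  congrFun (congrArg MGraph.Hom.onE f.comm) e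

/-- The map from the face boundaries of `Y` to the fiber product of the folded 1-skeleton of `f`
with the face boundaries of `X`. -/
def toFiberProd (f : Hom Y X) : MGraph.Hom Y.S (MGraph.Hom.fiberProd f.onG.ofFolded X.w) where
  onV u := ⟨(f.onG.toFolded.onV (Y.w.onV u), f.onS.onV u), (f.comm_V u).symm⟩
  onE e := ⟨(f.onG.toFolded.onE (Y.w.onE e), f.onS.onE e), (f.comm_E e).symm⟩
  map_ι e := Subtype.ext (Prod.ext
    (((f.onG.toFolded.comp Y.w).map_ι e)) (f.onS.map_ι e))
  map_τ e := Subtype.ext (Prod.ext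
    (((f.onG.toFolded.comp Y.w).map_τ e)) (f.onS.map_τ e))

/-- The projection of the image of `toFiberProd` to the face boundaries of `X`. -/
def imageToS (f : Hom Y X) : MGraph.Hom f.toFiberProd.image X.S where
  onV u := u.1.1.2
  onE e := e.1.1.2
  map_ι _ := rfl
  map_τ _ := rfl

theorem imageToS_isImmersion (f : Hom Y X) : f.imageToS.IsImmersion := by
  rintro ⟨⟨⟨e, s⟩, h⟩, hr⟩ ⟨⟨⟨e', s'⟩, h'⟩, hr'⟩ hb (he : s = s')
  subst he
  have h2 : e = e' := by
    refine f.onG.ofFolded_isImmersion e e' ?_ (h.trans h'.symm)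
    rcases hb with hb | hb
    · exact Or.inl (congrArg (fun x => x.1.1.1) hb)
    · exact Or.inr (congrArg (fun x => x.1.1.1) hb)
  subst h2
  rfl

/-- The folded representative of `f : Y → X`, as a complex: its 1-skeleton is the folded 1-skeleton
of `f`, and its face boundaries are the image of those of `Y` in the fiber product of the folded
1-skeleton with the face boundaries of `X`. -/
def foldedRep (f : Hom Y X) : TwoComplex.{u} where
  G := f.onG.folded
  S := f.toFiberProd.image
  w :=
    { onV := fun u => u.1.1.1
      onE := fun e => e.1.1.1
      map_ι := fun _ => rfl
      map_τ := fun _ => rfl }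
  cycles := MGraph.Hom.isUnionOfCycles_of_comp f.toFiberProd.toImage f.imageToS
    (by rintro ⟨_, u, rfl⟩; exact ⟨u, rfl⟩) f.imageToS_isImmersion f.onS_immersion
    Y.cycles X.cycles
  w_immersion := by
    rintro ⟨⟨⟨e, s⟩, h⟩, hr⟩ ⟨⟨⟨e', s'⟩, h'⟩, hr'⟩ hb (he : e = e')
    subst he
    have h2 : s = s' := by
      refine X.w_immersion s s' ?_ (h.symm.trans h')
      rcases hb with hb | hb
      · exact Or.inl (congrArg (fun x => x.1.1.2) hb)
      · exact Or.inr (congrArg (fun x => x.1.1.2) hb)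
    subst h2
    rfl

/-- The map from `Y` to the folded representative of `f : Y → X`. -/
def toFoldedRep (f : Hom Y X) : Hom Y f.foldedRep where
  onG := f.onG.toFolded
  onS := f.toFiberProd.toImage
  comm := rfl
  onS_immersion := fun e e' h he =>
    f.onS_immersion e e' h (congrArg (fun x => x.1.1.2) he)

/-- The map from the folded representative of `f : Y → X` to `X`. -/
def ofFoldedRep (f : Hom Y X) : Hom f.foldedRep X where
  onG := f.onG.ofFolded
  onS := f.imageToS
  comm := by
    refine MGraph.Hom.ext ?_ ?_
    · funext u
      exact u.1.2.symm
    · funext e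
      exact e.1.2.symm
  onS_immersion := f.imageToS_isImmersion

/-- `f` is face-essential if the map to its folded representative is a face-equivalence, that is,
if folding `f` does not identify any faces. -/
def IsFaceEssential (f : Hom Y X) : Prop := f.toFoldedRep.IsFaceEquivalence

end Hom

end TwoComplex

-- The problem is reduced to maximizing a ratio of linear functionals over nonnegative integer
-- solutions of finitely many linear equations.
--
-- For a face-essential map from `Y` to `X`, call the vertices of the folded 1-skeleton positions.
-- No faces are identified by folding, so a vertex of the face boundaries of `Y` is determined by
-- its position and its image in `X.S`. The part of `Y` over one position is therefore described by
-- a subset of `X.S.V` and two relations, telling which passages share a vertex or a half-edge of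
-- `Y`. This is a `Code`, and a finite `X` has only finitely many (`Code.finite`).
--
-- Degree, number of vertices and number of edges are sums over positions of quantities read off
-- from the codes (`deg_eq_sum`, `totalCurvature_eq_sum`), so degree and total curvature are
-- additive in the vector counting how often each code appears. Each edge `e` of `X` matches the
-- positions at its two ends (`exists_perm`), which gives linear gluing equations for this vector.
-- Conversely, any nonzero solution supported on codes that occur in visibly irreducible complexes
-- can be glued to a finite complex over `X` (`exists_framing_of_mem_codeVectors`). The result is
-- visibly irreducible because that condition is local and visible in the codes
-- (`visiblyIrreducible_of_occurs`), and its map is face-essential because folding never merges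
-- different positions (`isFaceEssential`).
--
-- The solution set is closed under subtraction of smaller solutions, so each nonzero solution is a
-- sum of minimal ones. By Dickson's lemma there are finitely many minimal ones, and the best of
-- them maximizes the ratio (`exists_max_ratio`).

namespace MGraph

-- Coverings of unions of cycles

theorem IsUnionOfCycles.finite_star {G : MGraph.{u}} (hG : G.IsUnionOfCycles) (v : G.V) :
    Finite (G.Star v) :=
  Nat.finite_of_card_ne_zero (by have := hG.valence_eq_two v; unfold valence at this; omega)

namespace Hom

variable {G H : MGraph.{u}}

/-- An immersion between unions of cycles is a covering map: half-edges lift. -/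
theorem IsImmersion.exists_half_lift {f : Hom G H} (hf : f.IsImmersion) (hG : G.IsUnionOfCycles)
    (hH : H.IsUnionOfCycles) (a : G.V) (h : H.Half) (hb : H.base h = f.onV a) :
    ∃ g : G.Half, G.base g = a ∧ f.onHalf g = h := by
  let s : G.Star a → H.Star (f.onV a) := fun h => ⟨f.onHalf h.1, by rw [base_onHalf, h.2]⟩
  have hs : Function.Injective s := fun h h' e =>
    Subtype.ext (hf.half_inj (h.2.trans h'.2.symm) (congrArg Subtype.val e))
  have := hH.finite_star (f.onV a)
  have hc : Nat.card (G.Star a) = Nat.card (H.Star (f.onV a)) :=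
    (hG.valence_eq_two a).trans (hH.valence_eq_two _).symm
  obtain ⟨⟨g, hg⟩, e⟩ := ((Nat.bijective_iff_injective_and_card s).2 ⟨hs, hc⟩).2 ⟨h, hb⟩
  exact ⟨g, hg, congrArg Subtype.val e⟩

theorem IsImmersion.exists_lift_ι {f : Hom G H} (hf : f.IsImmersion) (hG : G.IsUnionOfCycles)
    (hH : H.IsUnionOfCycles) (a : G.V) (ε : H.E) (hb : H.ι ε = f.onV a) :
    ∃ η : G.E, G.ι η = a ∧ f.onE η = ε := by
  obtain ⟨g | g, hg, h⟩ := hf.exists_half_lift hG hH a (Sum.inl ε) hb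
  · exact ⟨g, hg, Sum.inl_injective h⟩
  · cases h

theorem IsImmersion.exists_lift_τ {f : Hom G H} (hf : f.IsImmersion) (hG : G.IsUnionOfCycles)
    (hH : H.IsUnionOfCycles) (a : G.V) (ε : H.E) (hb : H.τ ε = f.onV a) :
    ∃ η : G.E, G.τ η = a ∧ f.onE η = ε := by
  obtain ⟨g | g, hg, h⟩ := hf.exists_half_lift hG hH a (Sum.inr ε) hb
  · cases h
  · exact ⟨g, hg, Sum.inr_injective h⟩

theorem connSetoid_map (f : Hom G H) {u u' : G.V} (h : G.connSetoid u u') :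
    H.connSetoid (f.onV u) (f.onV u') := by
  change Relation.EqvGen _ _ _ at h
  change Relation.EqvGen _ _ _
  induction h with
  | rel u u' h =>
    obtain ⟨e, rfl, rfl⟩ := h
    exact Relation.EqvGen.rel _ _ ⟨f.onE e, f.map_ι e, f.map_τ e⟩
  | refl => exact .refl _
  | symm _ _ _ ih => exact ih.symm
  | trans _ _ _ _ _ ih ih' => exact ih.trans _ _ _ ih'

/-- The number of points of a given component in a fiber of a covering map is locally constant. -/
theorem IsImmersion.card_fiber_eq {f : Hom G H} (hf : f.IsImmersion) (hG : G.IsUnionOfCycles)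
    (hH : H.IsUnionOfCycles) (C : G.Comp) {s s' : H.V} (h : H.connSetoid s s') :
    Nat.card {y : G.V // (Quotient.mk _ y : G.Comp) = C ∧ f.onV y = s} =
      Nat.card {y : G.V // (Quotient.mk _ y : G.Comp) = C ∧ f.onV y = s'} := by
  change Relation.EqvGen _ _ _ at h
  induction h with
  | rel s s' h =>
    obtain ⟨ε, rfl, rfl⟩ := h
    have hc : ∀ η : G.E, (Quotient.mk _ (G.ι η) : G.Comp) = Quotient.mk _ (G.τ η) :=
      fun η => Quotient.sound (Relation.EqvGen.rel _ _ ⟨η, rfl, rfl⟩)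
    -- The edges of `C` over `ε` biject with both fibers, by their initial and by their terminal
    -- vertices.
    let F := {η : G.E // (Quotient.mk _ (G.ι η) : G.Comp) = C ∧ f.onE η = ε}
    let a : F → {y : G.V // (Quotient.mk _ y : G.Comp) = C ∧ f.onV y = H.ι ε} :=
      fun η => ⟨G.ι η.1, η.2.1, by rw [← f.map_ι, η.2.2]⟩
    let b : F → {y : G.V // (Quotient.mk _ y : G.Comp) = C ∧ f.onV y = H.τ ε} :=
      fun η => ⟨G.τ η.1, (hc η.1).symm.trans η.2.1, by rw [← f.map_τ, η.2.2]⟩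
    have ha : Function.Bijective a := by
      refine ⟨fun η η' e => Subtype.ext ?_, ?_⟩
      · exact hf _ _ (Or.inl (congrArg Subtype.val e)) (η.2.2.trans η'.2.2.symm)
      · rintro ⟨y, hy, hy'⟩
        obtain ⟨η, rfl, h⟩ := hf.exists_lift_ι hG hH y ε hy'.symm
        exact ⟨⟨η, hy, h⟩, rfl⟩
    have hb : Function.Bijective b := by
      refine ⟨fun η η' e => Subtype.ext ?_, ?_⟩
      · exact hf _ _ (Or.inr (congrArg Subtype.val e)) (η.2.2.trans η'.2.2.symm)
      · rintro ⟨y, hy, hy'⟩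
        obtain ⟨η, rfl, h⟩ := hf.exists_lift_τ hG hH y ε hy'.symm
        exact ⟨⟨η, (hc η).trans hy, h⟩, rfl⟩
    exact (Nat.card_eq_of_bijective a ha).symm.trans (Nat.card_eq_of_bijective b hb)
  | refl => rfl
  | symm _ _ _ ih => exact ih.symm
  | trans _ _ _ _ _ ih ih' => exact ih.trans ih'

end Hom

/-- A set of base points, one in each component. -/
def basePoints (G : MGraph.{u}) : Set G.V := {s | (Quotient.mk _ s : G.Comp).out = s}

end MGraph

-- The degree as a count over base points

namespace TwoComplex.Hom

variable {X Y : TwoComplex.{u}}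

/-- The fiber through the arbitrary point `C.out` is moved to the fiber over the base point of the
image component. The base points depend only on `X`, which makes the degree a count that can be
distributed over positions. -/
theorem degAt_eq (f : Hom Y X) (C : Y.S.Comp) :
    f.degAt C = Nat.card {y : Y.S.V // (Quotient.mk _ y : Y.S.Comp) = C ∧
      f.onS.onV y ∈ X.S.basePoints} := by
  have hout : X.S.connSetoid (f.onS.onV C.out)
      (Quotient.mk _ (f.onS.onV C.out) : X.S.Comp).out :=
    Setoid.symm' _ (Quotient.mk_out (s := X.S.connSetoid) (f.onS.onV C.out))
  unfold degAt
  rw [f.onS_immersion.card_fiber_eq Y.cycles X.cycles C hout]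
  refine Nat.card_congr (Equiv.subtypeEquivRight fun y => and_congr_right fun hy => ?_)
  have hyC : Y.S.connSetoid y C.out := Quotient.exact (hy.trans (Quotient.out_eq C).symm)
  have he : (Quotient.mk _ (f.onS.onV y) : X.S.Comp) = Quotient.mk _ (f.onS.onV C.out) :=
    Quotient.sound (f.onS.connSetoid_map hyC)
  rw [← he]
  exact eq_comm

theorem deg_eq_card (f : Hom Y X) [Finite Y.S.V] :
    f.deg = Nat.card {y : Y.S.V // f.onS.onV y ∈ X.S.basePoints} := by
  have : Fintype Y.S.Comp := Fintype.ofFinite _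
  unfold deg
  rw [finsum_eq_sum_of_fintype]
  simp_rw [degAt_eq]
  rw [← Nat.card_sigma]
  refine Nat.card_congr
    { toFun := fun y => ⟨y.2.1, y.2.2.2⟩
      invFun := fun y => ⟨Quotient.mk _ y.1, y.1, rfl, y.2⟩
      left_inv := ?_
      right_inv := fun _ => rfl }
  rintro ⟨_, y, rfl, h⟩
  rfl

theorem deg_pos (f : Hom Y X) [Finite Y.S.V] [Nonempty Y.S.V] : 0 < f.deg := by
  have : Fintype Y.S.Comp := Fintype.ofFinite _
  let y : Y.S.V := Classical.arbitrary _
  let C : Y.S.Comp := Quotient.mk _ y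
  have hC : 0 < f.degAt C :=
    have : Nonempty {y : Y.S.V // (Quotient.mk _ y : Y.S.Comp) = C ∧
      f.onS.onV y = f.onS.onV C.out} := ⟨⟨C.out, Quotient.out_eq C, rfl⟩⟩
    Nat.card_pos
  unfold deg
  rw [finsum_eq_sum_of_fintype]
  exact Finset.sum_pos' (fun _ _ => Nat.zero_le _) ⟨C, Finset.mem_univ _, hC⟩

end TwoComplex.Hom

-- Fibers and permutations of finite sets

theorem Nat.card_eq_sum_fiber {α P : Type*} [Finite α] [Fintype P] (g : α → P) :
    Nat.card α = ∑ p, Nat.card {a // g a = p} := by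
  rw [← Nat.card_sigma]
  exact Nat.card_congr (Equiv.sigmaFiberEquiv g).symm

/-- Two maps into a finite set with the same fibers differ by a permutation. -/
theorem Equiv.Perm.exists_apply_eq_of_eq_iff {A P : Type*} [Finite P] (a b : A → P)
    (h : ∀ x y, a x = a y ↔ b x = b y) : ∃ φ : Equiv.Perm P, ∀ x, φ (a x) = b x := by
  classical
  have := Fintype.ofFinite P
  let g : {p // p ∈ Set.range a} → {p // p ∈ Set.range b} := fun p => ⟨b p.2.choose, _, rfl⟩
  have hg : ∀ x, (g ⟨a x, x, rfl⟩).1 = b x := fun x =>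
    (h _ _).1 (Exists.choose_spec (⟨x, rfl⟩ : a x ∈ Set.range a))
  have hb : Function.Bijective g := by
    constructor
    · rintro ⟨_, x, rfl⟩ ⟨_, y, rfl⟩ e
      have e := congrArg Subtype.val e
      rw [hg, hg] at e
      exact Subtype.ext ((h x y).2 e)
    · rintro ⟨_, x, rfl⟩
      exact ⟨⟨a x, x, rfl⟩, Subtype.ext (hg x)⟩
  -- A bijection between two subsets of a finite set extends to a permutation, since the complements
  -- have the same size.
  refine ⟨(Equiv.ofBijective g hb).extendSubtype, fun x => ?_⟩
  rw [Equiv.extendSubtype_apply_of_mem _ _ ⟨x, rfl⟩]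
  exact hg x

-- Framings and face-essential maps

namespace TwoComplex

variable {X Y Y' : TwoComplex.{u}}

/-- The Whitehead graph at the base of a half-edge is connected with at least two vertices, so the
half-edge has a neighbour, and an adjacency is a passage of a face. -/
theorem VisiblyIrreducible.onHalf_surjective (hY : Y.VisiblyIrreducible) :
    Function.Surjective Y.w.onHalf := by
  intro a
  simp only [VisiblyIrreducible, VisiblyReducible, not_or, not_exists, not_not] at hY
  obtain ⟨⟨-, h1, -, h2⟩, -⟩ := hY
  let a' : Y.G.Star (Y.G.base a) := ⟨a, rfl⟩
  have : Nontrivial (Y.G.Star (Y.G.base a)) := by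
    by_contra hn
    rw [not_nontrivial_iff_subsingleton] at hn
    have : Nonempty (Y.G.Star (Y.G.base a)) := ⟨a'⟩
    exact h1 (Y.G.base a) Nat.card_unique
  obtain ⟨b, -, s, -, -, -, hs, -⟩ := (h2 (Y.G.base a)).exists_adj_of_nontrivial a'
  exact ⟨s, hs⟩

theorem VisiblyIrreducible.onE_surjective (hY : Y.VisiblyIrreducible) :
    Function.Surjective Y.w.onE := by
  intro e
  obtain ⟨s | s, hs⟩ := hY.onHalf_surjective (Sum.inl e)
  · exact ⟨s, Sum.inl_injective hs⟩
  · cases hs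

theorem VisiblyIrreducible.onV_surjective (hY : Y.VisiblyIrreducible) :
    Function.Surjective Y.w.onV := by
  intro v
  have h := hY.1
  simp only [VisiblyReducible, not_or, not_exists, not_isEmpty_iff] at h
  obtain ⟨a, rfl⟩ := h.1 v
  obtain ⟨s, rfl⟩ := hY.onHalf_surjective a
  exact ⟨Y.S.base s, (Y.w.base_onHalf s).symm⟩

namespace Hom

/-- A framing of `f : Y → X` records, by the positions of the vertices of the face boundaries, a
factorization of the 1-skeleton of `f` through an immersed graph with vertex set `P`, such that no
faces of `Y` are identified in that graph. The 1-skeleton of `Y` is covered by its faces. -/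
structure Framing (f : Hom Y X) (P : Type u) where
  pos : Y.S.V → P
  pos_surjective : Function.Surjective pos
  onV_surjective : Function.Surjective Y.w.onV
  onE_surjective : Function.Surjective Y.w.onE
  pos_eq_of_onV_eq : ∀ {u u'}, Y.w.onV u = Y.w.onV u' → pos u = pos u'
  eq_of_pos_eq : ∀ {u u'}, pos u = pos u' → f.onS.onV u = f.onS.onV u' → u = u'
  pos_iff : ∀ η η', X.w.onE (f.onS.onE η) = X.w.onE (f.onS.onE η') →
    (pos (Y.S.ι η) = pos (Y.S.ι η') ↔ pos (Y.S.τ η) = pos (Y.S.τ η'))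

/-- A face-essential map from a visibly irreducible complex is framed by its folded
1-skeleton. -/
noncomputable def IsFaceEssential.framing {f : Hom Y X} (hf : f.IsFaceEssential)
    (hY : Y.VisiblyIrreducible) : f.Framing f.onG.folded.V where
  pos u := f.onG.toFolded.onV (Y.w.onV u)
  pos_surjective := Quotient.mk_surjective.comp hY.onV_surjective
  onV_surjective := hY.onV_surjective
  onE_surjective := hY.onE_surjective
  pos_eq_of_onV_eq h := congrArg _ h
  eq_of_pos_eq {u u'} h h' := hf.1.1 (Subtype.ext (Subtype.ext (Prod.ext h h')))
  pos_iff η η' h := by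
    have hi := f.onG.ofFolded_isImmersion (f.onG.toFolded.onE (Y.w.onE η))
      (f.onG.toFolded.onE (Y.w.onE η'))
    have he : f.onG.ofFolded.onE (f.onG.toFolded.onE (Y.w.onE η)) =
        f.onG.ofFolded.onE (f.onG.toFolded.onE (Y.w.onE η')) :=
      (f.comm_E η).symm.trans (h.trans (f.comm_E η'))
    rw [← Y.w.map_ι, ← Y.w.map_ι, ← Y.w.map_τ, ← Y.w.map_τ, ← MGraph.Hom.map_ι,
      ← MGraph.Hom.map_ι, ← MGraph.Hom.map_τ, ← MGraph.Hom.map_τ]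
    exact ⟨fun h => congrArg _ (hi (Or.inl h) he), fun h => congrArg _ (hi (Or.inr h) he)⟩

namespace Framing

variable {f : Hom Y X} {P : Type u} (F : f.Framing P)

/-- The position of a vertex of the 1-skeleton. -/
noncomputable def posG (v : Y.G.V) : P := F.pos (Function.surjInv F.onV_surjective v)

theorem posG_onV (u : Y.S.V) : F.posG (Y.w.onV u) = F.pos u :=
  F.pos_eq_of_onV_eq (Function.surjInv_eq F.onV_surjective _)

theorem posG_iff (e e' : Y.G.E) (h : f.onG.onE e = f.onG.onE e') :
    F.posG (Y.G.ι e) = F.posG (Y.G.ι e') ↔ F.posG (Y.G.τ e) = F.posG (Y.G.τ e') := by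
  obtain ⟨η, rfl⟩ := F.onE_surjective e
  obtain ⟨η', rfl⟩ := F.onE_surjective e'
  simp only [Y.w.map_ι, Y.w.map_τ, posG_onV]
  exact F.pos_iff η η' (by rw [f.comm_E, f.comm_E, h])

-- A fold merges edges with the same image in `X` and a common end. By `posG_iff`, agreement of
-- positions at one end passes to the other, so no sequence of folds merges vertices at different
-- positions.
mutual
theorem posG_eq_of_foldV : ∀ {v v' : Y.G.V}, MGraph.Hom.FoldV f.onG v v' → F.posG v = F.posG v'
  | _, _, .refl _ => rfl
  | _, _, .symm h => (posG_eq_of_foldV h).symm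
  | _, _, .trans h h' => (posG_eq_of_foldV h).trans (posG_eq_of_foldV h')
  | _, _, .ι h => posG_eq_of_foldE h
  | _, _, .τ h => (F.posG_iff _ _ h.onE_eq).1 (posG_eq_of_foldE h)
theorem posG_eq_of_foldE : ∀ {e e' : Y.G.E}, MGraph.Hom.FoldE f.onG e e' →
    F.posG (Y.G.ι e) = F.posG (Y.G.ι e')
  | _, _, .refl _ => rfl
  | _, _, .symm h => (posG_eq_of_foldE h).symm
  | _, _, .trans h h' => (posG_eq_of_foldE h).trans (posG_eq_of_foldE h')
  | _, _, .ι h _ => posG_eq_of_foldV h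
  | _, _, .τ h h' => (F.posG_iff _ _ h').2 (posG_eq_of_foldV h)
end

/-- The positions need not be the vertices of the folded graph: it suffices that folding respects
them, since position and image in `X.S` already separate the vertices of `Y.S`. -/
theorem isFaceEssential (F : f.Framing P) : f.IsFaceEssential := by
  have key : Function.Injective f.toFoldedRep.onS.onV := by
    intro u u' h
    have h := congrArg (fun x => x.1.1) h
    have h1 : MGraph.Hom.FoldV f.onG (Y.w.onV u) (Y.w.onV u') :=
      Quotient.exact (congrArg Prod.fst h)
    have h2 := F.posG_eq_of_foldV h1
    rw [posG_onV, posG_onV] at h2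
    exact F.eq_of_pos_eq h2 (congrArg Prod.snd h)
  refine ⟨⟨key, ?_⟩, ?_, ?_⟩
  · rintro ⟨_, u, rfl⟩; exact ⟨u, rfl⟩
  · intro e e' h
    refine f.toFoldedRep.onS_immersion e e' (Or.inl (key ?_)) h
    rw [← MGraph.Hom.map_ι, ← MGraph.Hom.map_ι, h]
  · rintro ⟨_, u, rfl⟩; exact ⟨u, rfl⟩

theorem half_eq {k k' : Y.S.Half} (h : F.pos (Y.S.base k) = F.pos (Y.S.base k'))
    (h' : f.onS.onHalf k = f.onS.onHalf k') : k = k' :=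
  f.onS_immersion.half_inj
    (F.eq_of_pos_eq h (by rw [← MGraph.Hom.base_onHalf, ← MGraph.Hom.base_onHalf, h'])) h'

theorem edge_eq_of_ι {η η' : Y.S.E} (h : F.pos (Y.S.ι η) = F.pos (Y.S.ι η'))
    (h' : f.onS.onE η = f.onS.onE η') : η = η' :=
  Sum.inl_injective (F.half_eq (k := Sum.inl η) (k' := Sum.inl η') h (congrArg Sum.inl h'))

end Framing

end Hom

/-- A code describes the part of a framed complex over `X` at one position: the set `T` of the
vertices of the face boundaries of `X` that occur there, and the relations `q` and `r` which tell
when two of them lie on the same vertex, and two half-edges on the same half-edge, of the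
1-skeleton. -/
@[ext]
structure Code (X : TwoComplex.{u}) where
  T : Set X.S.V
  q : X.S.V → X.S.V → Prop
  r : X.S.Half → X.S.Half → Prop

theorem Code.finite (hX : X.IsFinite) : Finite X.Code := by
  have := hX.finite_SV
  have := hX.finite_SE
  refine Finite.of_injective
    (fun t : X.Code => ((t.T, t.q, t.r) :
      Set X.S.V × (X.S.V → X.S.V → Prop) × (X.S.Half → X.S.Half → Prop))) ?_
  rintro ⟨⟩ ⟨⟩ h
  simpa using h

namespace Code

/-- The number of vertices of the 1-skeleton at a position. -/
noncomputable def numV (t : X.Code) : ℕ := ((fun s => {s' | t.q s s'}) '' t.T).ncard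

/-- The number of edges of the 1-skeleton that start at a position. -/
noncomputable def numE (t : X.Code) : ℕ :=
  ((fun ε => {ε' | t.r (Sum.inl ε) (Sum.inl ε')}) '' {ε | X.S.ι ε ∈ t.T}).ncard

/-- The contribution of a position to the degree. -/
noncomputable def deg (t : X.Code) : ℕ := (t.T ∩ X.S.basePoints).ncard

/-- The faces that leave a position along `e`, and the relation of passing through the same edge. -/
def out (e : X.G.E) (t : X.Code) : Set X.S.E × (X.S.E → X.S.E → Prop) :=
  ({ε | X.w.onE ε = e ∧ X.S.ι ε ∈ t.T},
    fun ε ε' => X.w.onE ε = e ∧ t.r (Sum.inl ε) (Sum.inl ε'))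

/-- The faces that enter a position along `e`, and the relation of passing through the same
edge. -/
def into (e : X.G.E) (t : X.Code) : Set X.S.E × (X.S.E → X.S.E → Prop) :=
  ({ε | X.w.onE ε = e ∧ X.S.τ ε ∈ t.T},
    fun ε ε' => X.w.onE ε = e ∧ t.r (Sum.inr ε) (Sum.inr ε'))

end Code

-- Codes of a framed complex: local counts and matching along edges

namespace Hom.Framing

variable {f : Hom Y X} {P : Type u} (F : f.Framing P)

/-- The code of a position. -/
def code (p : P) : X.Code where
  T := {s | ∃ u, F.pos u = p ∧ f.onS.onV u = s}
  q s s' := ∃ u u', F.pos u = p ∧ F.pos u' = p ∧ f.onS.onV u = s ∧ f.onS.onV u' = s' ∧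
    Y.w.onV u = Y.w.onV u'
  r h h' := ∃ k k', F.pos (Y.S.base k) = p ∧ F.pos (Y.S.base k') = p ∧ f.onS.onHalf k = h ∧
    f.onS.onHalf k' = h' ∧ Y.w.onHalf k = Y.w.onHalf k'

/-- The existential in `code` has only one candidate for each lift, by `eq_of_pos_eq`, so the code
loses no information. -/
theorem code_q_iff {p : P} {u u' : Y.S.V} (h : F.pos u = p) (h' : F.pos u' = p) :
    (F.code p).q (f.onS.onV u) (f.onS.onV u') ↔ Y.w.onV u = Y.w.onV u' := by
  refine ⟨?_, fun e => ⟨u, u', h, h', rfl, rfl, e⟩⟩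
  rintro ⟨a, a', ha, ha', e, e', hw⟩
  obtain rfl := F.eq_of_pos_eq (ha.trans h.symm) e
  obtain rfl := F.eq_of_pos_eq (ha'.trans h'.symm) e'
  exact hw

theorem code_r_iff {p : P} {k k' : Y.S.Half} (h : F.pos (Y.S.base k) = p)
    (h' : F.pos (Y.S.base k') = p) :
    (F.code p).r (f.onS.onHalf k) (f.onS.onHalf k') ↔ Y.w.onHalf k = Y.w.onHalf k' := by
  refine ⟨?_, fun e => ⟨k, k', h, h', rfl, rfl, e⟩⟩
  rintro ⟨a, a', ha, ha', e, e', hw⟩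
  obtain rfl := F.half_eq (ha.trans h.symm) e
  obtain rfl := F.half_eq (ha'.trans h'.symm) e'
  exact hw

theorem code_r_inl_iff {p : P} {η η' : Y.S.E} (h : F.pos (Y.S.ι η) = p)
    (h' : F.pos (Y.S.ι η') = p) :
    (F.code p).r (Sum.inl (f.onS.onE η)) (Sum.inl (f.onS.onE η')) ↔
      Y.w.onE η = Y.w.onE η' :=
  (F.code_r_iff (k := Sum.inl η) (k' := Sum.inl η') h h').trans Sum.inl_injective.eq_iff

theorem exists_lift {p : P} (h : X.S.Half) (hT : X.S.base h ∈ (F.code p).T) :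
    ∃ k : Y.S.Half, F.pos (Y.S.base k) = p ∧ f.onS.onHalf k = h := by
  obtain ⟨u, rfl, hu⟩ := hT
  obtain ⟨k, rfl, hk⟩ := f.onS_immersion.exists_half_lift Y.cycles X.cycles u h hu.symm
  exact ⟨k, rfl, hk⟩

theorem exists_lift_ι {p : P} (ε : X.S.E) (hT : X.S.ι ε ∈ (F.code p).T) :
    ∃ η : Y.S.E, F.pos (Y.S.ι η) = p ∧ f.onS.onE η = ε := by
  obtain ⟨k | k, hk, h⟩ := F.exists_lift (Sum.inl ε) hT
  · exact ⟨k, hk, Sum.inl_injective h⟩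
  · cases h

theorem exists_lift_τ {p : P} (ε : X.S.E) (hT : X.S.τ ε ∈ (F.code p).T) :
    ∃ η : Y.S.E, F.pos (Y.S.τ η) = p ∧ f.onS.onE η = ε := by
  obtain ⟨k | k, hk, h⟩ := F.exists_lift (Sum.inr ε) hT
  · cases h
  · exact ⟨k, hk, Sum.inr_injective h⟩

/-- At a fixed position, a vertex is recovered from the set of images in `X.S` of the passages
through it. These sets are exactly the classes of `q`. -/
theorem card_posG_fiber (p : P) : Nat.card {v // F.posG v = p} = (F.code p).numV := by
  let A : Y.G.V → Set X.S.V := fun v => {s | ∃ u, Y.w.onV u = v ∧ f.onS.onV u = s}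
  have hA : ∀ u, {s' | (F.code (F.pos u)).q (f.onS.onV u) s'} = A (Y.w.onV u) := by
    intro u
    ext s'
    constructor
    · rintro ⟨a, a', ha, ha', e, e', hw⟩
      obtain rfl := F.eq_of_pos_eq ha e
      exact ⟨a', hw.symm, e'⟩
    · rintro ⟨a, ha, rfl⟩
      exact (F.code_q_iff rfl (F.pos_eq_of_onV_eq ha)).2 ha.symm
  have hi : Set.InjOn A {v | F.posG v = p} := by
    intro v hv v' hv' h
    obtain ⟨u, rfl⟩ := F.onV_surjective v
    obtain ⟨u', rfl⟩ := F.onV_surjective v'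
    have hm : f.onS.onV u ∈ A (Y.w.onV u') := h ▸ ⟨u, rfl, rfl⟩
    obtain ⟨a, ha, ha'⟩ := hm
    have h1 : F.pos a = F.pos u := by
      rw [F.pos_eq_of_onV_eq ha, ← F.posG_onV, ← F.posG_onV]
      exact hv'.trans hv.symm
    rw [← F.eq_of_pos_eq h1 ha', ha]
  have hS : (fun s => {s' | (F.code p).q s s'}) '' (F.code p).T = A '' {v | F.posG v = p} := by
    ext B
    constructor
    · rintro ⟨_, ⟨u, rfl, rfl⟩, rfl⟩
      exact ⟨Y.w.onV u, F.posG_onV u, (hA u).symm⟩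
    · rintro ⟨v, hv, rfl⟩
      obtain ⟨u, rfl⟩ := F.onV_surjective v
      rw [Set.mem_ofPred_eq, F.posG_onV] at hv
      subst hv
      exact ⟨f.onS.onV u, ⟨u, rfl, rfl⟩, hA u⟩
  rw [Code.numV, hS, hi.ncard_image]
  rfl

/-- The same argument for edges, each counted once, at the position of its initial vertex. -/
theorem card_posG_ι_fiber (p : P) :
    Nat.card {e // F.posG (Y.G.ι e) = p} = (F.code p).numE := by
  let A : Y.G.E → Set X.S.E := fun e => {ε | ∃ η, Y.w.onE η = e ∧ f.onS.onE η = ε}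
  have hpos : ∀ {η η' : Y.S.E}, Y.w.onE η = Y.w.onE η' → F.pos (Y.S.ι η) = F.pos (Y.S.ι η') :=
    fun h => F.pos_eq_of_onV_eq (by rw [← Y.w.map_ι, ← Y.w.map_ι, h])
  have hposG : ∀ η, F.posG (Y.G.ι (Y.w.onE η)) = F.pos (Y.S.ι η) := fun η => by
    rw [Y.w.map_ι, F.posG_onV]
  have hA : ∀ η, {ε' | (F.code (F.pos (Y.S.ι η))).r (Sum.inl (f.onS.onE η)) (Sum.inl ε')} =
      A (Y.w.onE η) := by
    intro η
    ext ε'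
    constructor
    · rintro ⟨a, a' | a', ha, ha', e, e', hw⟩
      · obtain rfl := F.half_eq (k' := Sum.inl η) ha e
        exact ⟨a', (Sum.inl_injective hw).symm, Sum.inl_injective e'⟩
      · cases e'
    · rintro ⟨a, ha, rfl⟩
      exact (F.code_r_inl_iff rfl (hpos ha)).2 ha.symm
  have hi : Set.InjOn A {e | F.posG (Y.G.ι e) = p} := by
    intro v hv v' hv' h
    obtain ⟨η, rfl⟩ := F.onE_surjective v
    obtain ⟨η', rfl⟩ := F.onE_surjective v'
    have hm : f.onS.onE η ∈ A (Y.w.onE η') := h ▸ ⟨η, rfl, rfl⟩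
    obtain ⟨a, ha, ha'⟩ := hm
    have h1 : F.pos (Y.S.ι a) = F.pos (Y.S.ι η) := by
      rw [hpos ha, ← hposG, ← hposG]
      exact hv'.trans hv.symm
    rw [← F.edge_eq_of_ι h1 ha', ha]
  have hS : (fun ε => {ε' | (F.code p).r (Sum.inl ε) (Sum.inl ε')}) ''
      {ε | X.S.ι ε ∈ (F.code p).T} = A '' {e | F.posG (Y.G.ι e) = p} := by
    ext B
    constructor
    · rintro ⟨ε, hε, rfl⟩
      obtain ⟨η, rfl, rfl⟩ := F.exists_lift_ι ε hε
      exact ⟨Y.w.onE η, hposG η, (hA η).symm⟩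
    · rintro ⟨v, hv, rfl⟩
      obtain ⟨η, rfl⟩ := F.onE_surjective v
      rw [Set.mem_ofPred_eq, hposG] at hv
      subst hv
      exact ⟨f.onS.onE η, ⟨Y.S.ι η, rfl, (f.onS.map_ι η).symm⟩, hA η⟩
  rw [Code.numE, hS, hi.ncard_image]
  rfl

theorem card_basePoints_fiber (p : P) :
    Nat.card {u : {u : Y.S.V // f.onS.onV u ∈ X.S.basePoints} // F.pos u.1 = p} =
      (F.code p).deg := by
  have hi : Set.InjOn f.onS.onV {u | f.onS.onV u ∈ X.S.basePoints ∧ F.pos u = p} :=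
    fun u hu u' hu' h => F.eq_of_pos_eq (hu.2.trans hu'.2.symm) h
  have hS : (F.code p).T ∩ X.S.basePoints =
      f.onS.onV '' {u | f.onS.onV u ∈ X.S.basePoints ∧ F.pos u = p} := by
    ext s
    constructor
    · rintro ⟨⟨u, hu, rfl⟩, hs⟩
      exact ⟨u, ⟨hs, hu⟩, rfl⟩
    · rintro ⟨u, ⟨h, h'⟩, rfl⟩
      exact ⟨⟨u, h', rfl⟩, h⟩
  rw [Code.deg, hS, hi.ncard_image]
  exact Nat.card_congr (Equiv.subtypeSubtypeEquivSubtypeInter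
    (fun u => f.onS.onV u ∈ X.S.basePoints) (fun u => F.pos u = p))

theorem deg_eq_sum [Finite Y.S.V] [Fintype P] : f.deg = ∑ p, (F.code p).deg := by
  rw [deg_eq_card, Nat.card_eq_sum_fiber (fun u => F.pos u.1)]
  exact Finset.sum_congr rfl fun p _ => F.card_basePoints_fiber p

theorem totalCurvature_eq_sum (hY : Y.IsFinite) [Fintype P] :
    f.totalCurvature = ∑ p, (((F.code p).deg : ℤ) + (F.code p).numV - (F.code p).numE) := by
  have := hY.finite_V
  have := hY.finite_E
  have := hY.finite_SV
  rw [totalCurvature, MGraph.eulerChar, F.deg_eq_sum, Nat.card_eq_sum_fiber F.posG,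
    Nat.card_eq_sum_fiber (fun e => F.posG (Y.G.ι e))]
  simp only [card_posG_fiber, card_posG_ι_fiber, Finset.sum_sub_distrib, Finset.sum_add_distrib]
  push_cast
  ring

/-- Lifts of `e` give a partial bijection of positions, from initial to terminal ends. It is
extended arbitrarily to the positions that no face leaves along `e`; these go to positions that no
face enters along `e`, so both sides are empty there. -/
theorem exists_perm [Finite P] (e : X.G.E) :
    ∃ φ : Equiv.Perm P, ∀ p, (F.code (φ p)).into e = (F.code p).out e := by
  obtain ⟨φ, hφ⟩ := Equiv.Perm.exists_apply_eq_of_eq_iff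
    (A := {η : Y.S.E // X.w.onE (f.onS.onE η) = e})
    (fun η => F.pos (Y.S.ι η.1)) (fun η => F.pos (Y.S.τ η.1))
    (fun η η' => F.pos_iff _ _ (η.2.trans η'.2.symm))
  have key : ∀ p η, X.w.onE (f.onS.onE η) = e →
      (F.pos (Y.S.τ η) = φ p ↔ F.pos (Y.S.ι η) = p) := by
    intro p η h
    rw [← hφ ⟨η, h⟩, φ.injective.eq_iff]
  refine ⟨φ, fun p => Prod.ext ?_ ?_⟩
  · ext ε
    refine and_congr_right fun hε => ?_
    constructor
    · intro h
      obtain ⟨η, hη, rfl⟩ := F.exists_lift_τ ε h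
      exact ⟨Y.S.ι η, (key p η hε).1 hη, (f.onS.map_ι η).symm⟩
    · intro h
      obtain ⟨η, hη, rfl⟩ := F.exists_lift_ι ε h
      exact ⟨Y.S.τ η, (key p η hε).2 hη, (f.onS.map_τ η).symm⟩
  · ext ε ε'
    refine and_congr_right fun hε => ?_
    have hw : ∀ {k k' : Y.S.E}, Y.w.onE k = Y.w.onE k' → X.w.onE (f.onS.onE k) = e →
        X.w.onE (f.onS.onE k') = e := fun h h' => by rw [← h', f.comm_E, f.comm_E, h]
    constructor
    · rintro ⟨k | k, k' | k', hk, hk', e1, e2, h⟩ <;> cases e1 <;> cases e2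
      have h := Sum.inr_injective h
      exact ⟨Sum.inl k, Sum.inl k', (key p k hε).1 hk, (key p k' (hw h hε)).1 hk', rfl, rfl,
        congrArg Sum.inl h⟩
    · rintro ⟨k | k, k' | k', hk, hk', e1, e2, h⟩ <;> cases e1 <;> cases e2
      have h := Sum.inl_injective h
      exact ⟨Sum.inr k, Sum.inr k', (key p k hε).2 hk, (key p k' (hw h hε)).2 hk', rfl, rfl,
        congrArg Sum.inr h⟩

end Hom.Framing

end TwoComplex

-- Visible irreducibility is determined by the codes

namespace TwoComplex

variable {X Y Y' : TwoComplex.{u}}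

namespace Hom.Framing

section whitehead

variable {f : Hom Y X} {P : Type u} (F : f.Framing P) {f' : Hom Y' X} {P' : Type u}
  (F' : f'.Framing P')

/-- Half-edges of the 1-skeletons of two complexes over `X` that are traversed by faces in the same
way. -/
def Corr (f : Hom Y X) (f' : Hom Y' X) {v : Y.G.V} {v' : Y'.G.V} (a : Y.G.Star v)
    (a' : Y'.G.Star v') : Prop :=
  ∃ k k', Y.w.onHalf k = a.1 ∧ Y'.w.onHalf k' = a'.1 ∧ f.onS.onHalf k = f'.onS.onHalf k'

theorem onHalf_surjective (F : f.Framing P) : Function.Surjective Y.w.onHalf := by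
  rintro (e | e)
  · obtain ⟨η, rfl⟩ := F.onE_surjective e
    exact ⟨Sum.inl η, rfl⟩
  · obtain ⟨η, rfl⟩ := F.onE_surjective e
    exact ⟨Sum.inr η, rfl⟩

theorem pos_base_of_star {u : Y.S.V} (a : Y.G.Star (Y.w.onV u)) {k : Y.S.Half}
    (h : Y.w.onHalf k = a.1) : F.pos (Y.S.base k) = F.pos u :=
  F.pos_eq_of_onV_eq (by rw [← MGraph.Hom.base_onHalf, h, a.2])

variable {F F'} {u : Y.S.V} {u' : Y'.S.V} (hc : F.code (F.pos u) = F'.code (F'.pos u'))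
  (hu : f.onS.onV u = f'.onS.onV u')
include hc

theorem exists_corr_half (k : Y.S.Half) (hk : F.pos (Y.S.base k) = F.pos u) :
    ∃ k' : Y'.S.Half, F'.pos (Y'.S.base k') = F'.pos u' ∧
      f.onS.onHalf k = f'.onS.onHalf k' := by
  obtain ⟨k', hk', h⟩ := F'.exists_lift (p := F'.pos u') (f.onS.onHalf k)
    (by rw [← hc]; exact ⟨_, hk, (MGraph.Hom.base_onHalf _ _).symm⟩)
  exact ⟨k', hk', h.symm⟩

/-- Two passages through `a` are related by `r`; the equality of codes carries this relation over to
the other complex. -/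
theorem corr_unique {a : Y.G.Star (Y.w.onV u)} {a' b' : Y'.G.Star (Y'.w.onV u')}
    (h : Corr f f' a a') (h' : Corr f f' a b') : a' = b' := by
  obtain ⟨k, k', hk, hk', e⟩ := h
  obtain ⟨l, l', hl, hl', e'⟩ := h'
  have hr := (F.code_r_iff (F.pos_base_of_star a hk) (F.pos_base_of_star a hl)).2
    (hk.trans hl.symm)
  rw [hc, e, e', F'.code_r_iff (F'.pos_base_of_star a' hk') (F'.pos_base_of_star b' hl')] at hr
  exact Subtype.ext (by rw [← hk', hr, hl'])

include hu

/-- A position may contain several vertices; `q` ensures that the corresponding half-edge is at the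
right one. -/
theorem star_of_corr_half {k : Y.S.Half} {k' : Y'.S.Half}
    (hk : Y.w.onV (Y.S.base k) = Y.w.onV u)
    (hk' : F'.pos (Y'.S.base k') = F'.pos u') (h : f.onS.onHalf k = f'.onS.onHalf k') :
    Y'.G.base (Y'.w.onHalf k') = Y'.w.onV u' := by
  have hq := (F.code_q_iff (F.pos_eq_of_onV_eq hk) rfl).2 hk
  rw [hc, hu, ← MGraph.Hom.base_onHalf, h, MGraph.Hom.base_onHalf, F'.code_q_iff hk' rfl] at hq
  rw [MGraph.Hom.base_onHalf, hq]

theorem exists_corr (a : Y.G.Star (Y.w.onV u)) : ∃ a' : Y'.G.Star (Y'.w.onV u'),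
    Corr f f' a a' := by
  obtain ⟨k, hk⟩ := F.onHalf_surjective a.1
  obtain ⟨k', hk', h⟩ := exists_corr_half hc k (F.pos_base_of_star a hk)
  exact ⟨⟨Y'.w.onHalf k', star_of_corr_half hc hu
    (by rw [← MGraph.Hom.base_onHalf, hk, a.2]) hk' h⟩, k, k', hk, rfl, h⟩

theorem adj_of_corr {a b : Y.G.Star (Y.w.onV u)} {a' b' : Y'.G.Star (Y'.w.onV u')}
    (ha : Corr f f' a a') (hb : Corr f f' b b') (h : (Y.whitehead _).Adj a b) :
    (Y'.whitehead _).Adj a' b' := by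
  obtain ⟨hab, s, t, hst, hbase, hs, ht⟩ := h
  obtain ⟨s', hs', es⟩ := exists_corr_half hc s (F.pos_base_of_star a hs)
  obtain ⟨t', ht', et⟩ := exists_corr_half hc t (F.pos_base_of_star b ht)
  have hsb := star_of_corr_half hc hu (by rw [← MGraph.Hom.base_onHalf, hs, a.2]) hs' es
  have htb := star_of_corr_half hc hu (by rw [← MGraph.Hom.base_onHalf, ht, b.2]) ht' et
  have h1 : a' = ⟨_, hsb⟩ := corr_unique hc ha ⟨s, s', hs, rfl, es⟩
  have h2 : b' = ⟨_, htb⟩ := corr_unique hc hb ⟨t, t', ht, rfl, et⟩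
  have flip : ∀ {c : Y.G.Star (Y.w.onV u)} {c' : Y'.G.Star (Y'.w.onV u')},
      Corr f f' c c' → Corr f' f c' c :=
    fun ⟨k, k', hk, hk', e⟩ => ⟨k', k, hk', hk, e.symm⟩
  refine ⟨?_, s', t', ?_, ?_, by rw [h1], by rw [h2]⟩
  · rintro rfl
    exact hab (corr_unique hc.symm (flip ha) (flip hb))
  · rintro rfl
    exact hst (F.half_eq (by rw [hbase]) (es.trans et.symm))
  · refine F'.eq_of_pos_eq (hs'.trans ht'.symm) ?_
    rw [← MGraph.Hom.base_onHalf, ← MGraph.Hom.base_onHalf, ← es, ← et, MGraph.Hom.base_onHalf,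
      MGraph.Hom.base_onHalf, hbase]

/-- The Whitehead graph of a vertex is determined by the code of its position. -/
theorem nonempty_whitehead_iso :
    Nonempty (Y.whitehead (Y.w.onV u) ≃g Y'.whitehead (Y'.w.onV u')) := by
  choose α hα using exists_corr hc hu
  choose β hβ using exists_corr hc.symm hu.symm
  have flip : ∀ {c : Y.G.Star (Y.w.onV u)} {c' : Y'.G.Star (Y'.w.onV u')},
      Corr f' f c' c → Corr f f' c c' :=
    fun ⟨k, k', hk, hk', e⟩ => ⟨k', k, hk', hk, e.symm⟩
  have flip' : ∀ {c : Y.G.Star (Y.w.onV u)} {c' : Y'.G.Star (Y'.w.onV u')},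
      Corr f f' c c' → Corr f' f c' c :=
    fun ⟨k, k', hk, hk', e⟩ => ⟨k', k, hk', hk, e.symm⟩
  exact ⟨{
    toFun := α
    invFun := β
    left_inv := fun a => corr_unique hc.symm (hβ _) (flip' (hα a))
    right_inv := fun a => corr_unique hc (hα _) (flip (hβ a))
    map_rel_iff' := fun {a b} =>
      ⟨adj_of_corr hc.symm hu.symm (flip' (hα a)) (flip' (hα b)), adj_of_corr hc hu (hα a) (hα b)⟩ }⟩

end whitehead

end Hom.Framing

/-- A code that occurs in some visibly irreducible framed complex over `X`. -/
def Code.Occurs (t : X.Code) : Prop :=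
  ∃ (Y : TwoComplex.{u}) (f : Hom Y X) (P : Type u) (F : f.Framing P) (p : P),
    Y.VisiblyIrreducible ∧ F.code p = t

/-- Each condition concerns one Whitehead graph or the passages through one edge. Both can be
compared with a visibly irreducible complex having the same code at some position, possibly a
different complex for each position. -/
theorem Hom.Framing.visiblyIrreducible_of_occurs {f : Hom Y X} {P : Type u} (F : f.Framing P)
    (h : ∀ p, (F.code p).Occurs) : Y.VisiblyIrreducible := by
  have key : ∀ u : Y.S.V, ∃ (Y' : TwoComplex.{u}) (f' : Hom Y' X) (P' : Type u)
      (F' : f'.Framing P') (u' : Y'.S.V), Y'.VisiblyIrreducible ∧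
      F'.code (F'.pos u') = F.code (F.pos u) ∧ f'.onS.onV u' = f.onS.onV u := by
    intro u
    obtain ⟨Y', f', P', F', p', hY', hc⟩ := h (F.pos u)
    have hu : f.onS.onV u ∈ (F'.code p').T := by rw [hc]; exact ⟨u, rfl, rfl⟩
    obtain ⟨u', rfl, hu'⟩ := hu
    exact ⟨Y', f', P', F', u', hY', hc, hu'⟩
  have iso : ∀ v : Y.G.V, ∃ (Y' : TwoComplex.{u}) (v' : Y'.G.V), Y'.VisiblyIrreducible ∧
      Nonempty (Y.whitehead v ≃g Y'.whitehead v') := by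
    intro v
    obtain ⟨u, rfl⟩ := F.onV_surjective v
    obtain ⟨Y', f', P', F', u', hY', hc, hu⟩ := key u
    exact ⟨Y', _, hY', nonempty_whitehead_iso hc.symm hu.symm⟩
  refine ⟨?_, ?_⟩
  · rintro (⟨v, hv⟩ | ⟨v, hv⟩ | ⟨e, η, hη, huniq⟩ | ⟨v, hv⟩)
    · obtain ⟨Y', v', hY', ⟨φ⟩⟩ := iso v
      exact hY'.1 (Or.inl ⟨v', φ.toEquiv.symm.isEmpty⟩)
    · obtain ⟨Y', v', hY', ⟨φ⟩⟩ := iso v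
      exact hY'.1 (Or.inr (Or.inl ⟨v', (Nat.card_congr φ.toEquiv.symm).trans hv⟩))
    -- If `η` alone passes through `e`, then `η'` alone passes through its edge in `Y'`: the code
    -- turns any other passage `θ` there into a passage `ζ` through `e`, and `ζ` must be `η`.
    · obtain ⟨Y', f', P', F', u', hY', hc, hu⟩ := key (Y.S.ι η)
      obtain ⟨η', rfl, hη'⟩ := f'.onS_immersion.exists_lift_ι Y'.cycles X.cycles u' (f.onS.onE η)
        (by rw [hu, f.onS.map_ι])
      refine hY'.1 (Or.inr (Or.inr (Or.inl ⟨Y'.w.onE η', η', rfl, fun θ hθ => ?_⟩)))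
      have hpos : F'.pos (Y'.S.ι θ) = F'.pos (Y'.S.ι η') :=
        F'.pos_eq_of_onV_eq (by rw [← Y'.w.map_ι, ← Y'.w.map_ι, hθ])
      refine F'.edge_eq_of_ι hpos ?_
      have hr := (F'.code_r_inl_iff hpos rfl).2 hθ
      have hm : X.S.ι (f'.onS.onE θ) ∈ (F.code (F.pos (Y.S.ι η))).T := by
        rw [← hc]; exact ⟨_, hpos, (f'.onS.map_ι θ).symm⟩
      obtain ⟨ζ, hζ, eζ⟩ := F.exists_lift_ι _ hm
      rw [hc, ← eζ, hη', F.code_r_inl_iff hζ rfl, hη] at hr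
      rw [← eζ, huniq ζ hr, hη']
    · obtain ⟨Y', v', hY', ⟨φ⟩⟩ := iso v
      exact hY'.1 (Or.inr (Or.inr (Or.inr ⟨v', fun h' => hv (φ.preconnected_iff.2 h')⟩)))
  · rintro ⟨v, a, ha⟩
    obtain ⟨Y', v', hY', ⟨φ⟩⟩ := iso v
    refine hY'.2 ⟨v', φ a, fun h' => ha ?_⟩
    have hb : Set.BijOn φ {b | b ≠ a} {b | b ≠ φ a} := by
      refine ⟨fun b hb h => hb (φ.injective h), φ.injective.injOn, fun b hb => ?_⟩
      refine ⟨φ.symm b, fun h => hb ?_, φ.apply_symm_apply b⟩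
      rw [← h, φ.apply_symm_apply]
    exact (φ.induce hb).preconnected_iff.2 h'

namespace Code

/-- The properties of the code of a position of a framed complex that are needed for gluing. -/
structure Valid (t : X.Code) : Prop where
  nonempty : t.T.Nonempty
  q_refl : ∀ s ∈ t.T, t.q s s
  q_symm : ∀ s s', t.q s s' → t.q s' s
  q_trans : ∀ s s' s'', t.q s s' → t.q s' s'' → t.q s s''
  q_mem : ∀ s s', t.q s s' → s ∈ t.T ∧ s' ∈ t.T
  q_onV : ∀ s s', t.q s s' → X.w.onV s = X.w.onV s'
  r_refl : ∀ h, X.S.base h ∈ t.T → t.r h h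
  r_symm : ∀ h h', t.r h h' → t.r h' h
  r_trans : ∀ h h' h'', t.r h h' → t.r h' h'' → t.r h h''
  r_base : ∀ h h', t.r h h' → t.q (X.S.base h) (X.S.base h')
  r_onHalf : ∀ h h', t.r h h' → X.w.onHalf h = X.w.onHalf h'

end Code

theorem Hom.onHalf_comm (f : Hom Y X) (k : Y.S.Half) :
    X.w.onHalf (f.onS.onHalf k) = f.onG.onHalf (Y.w.onHalf k) := by
  rcases k with k | k
  · exact congrArg Sum.inl (f.comm_E k)
  · exact congrArg Sum.inr (f.comm_E k)

theorem Hom.Framing.code_valid {f : Hom Y X} {P : Type u} (F : f.Framing P) (p : P) :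
    (F.code p).Valid where
  nonempty := by
    obtain ⟨u, rfl⟩ := F.pos_surjective p
    exact ⟨_, u, rfl, rfl⟩
  q_refl := by rintro _ ⟨u, hu, rfl⟩; exact (F.code_q_iff hu hu).2 rfl
  q_symm := by
    rintro _ _ ⟨u, u', hu, hu', rfl, rfl, h⟩
    exact (F.code_q_iff hu' hu).2 h.symm
  q_trans := by
    rintro _ _ _ ⟨u, u', hu, hu', rfl, rfl, h⟩ ⟨a, a', ha, ha', e, rfl, h'⟩
    obtain rfl := F.eq_of_pos_eq (ha.trans hu'.symm) e
    exact (F.code_q_iff hu ha').2 (h.trans h')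
  q_mem := by rintro _ _ ⟨u, u', hu, hu', rfl, rfl, h⟩; exact ⟨⟨u, hu, rfl⟩, u', hu', rfl⟩
  q_onV := by
    rintro _ _ ⟨u, u', hu, hu', rfl, rfl, h⟩
    rw [f.comm_V, f.comm_V, h]
  r_refl := by
    intro h hh
    obtain ⟨k, hk, rfl⟩ := F.exists_lift h hh
    exact (F.code_r_iff hk hk).2 rfl
  r_symm := by
    rintro _ _ ⟨u, u', hu, hu', rfl, rfl, h⟩
    exact (F.code_r_iff hu' hu).2 h.symm
  r_trans := by
    rintro _ _ _ ⟨u, u', hu, hu', rfl, rfl, h⟩ ⟨a, a', ha, ha', e, rfl, h'⟩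
    obtain rfl := F.half_eq (ha.trans hu'.symm) e
    exact (F.code_r_iff hu ha').2 (h.trans h')
  r_base := by
    rintro _ _ ⟨u, u', hu, hu', rfl, rfl, h⟩
    rw [MGraph.Hom.base_onHalf, MGraph.Hom.base_onHalf, F.code_q_iff hu hu',
      ← MGraph.Hom.base_onHalf, ← MGraph.Hom.base_onHalf, h]
  r_onHalf := by
    rintro _ _ ⟨u, u', hu, hu', rfl, rfl, h⟩
    rw [f.onHalf_comm, f.onHalf_comm, h]

/-! ### Gluing -/

/-- Gluing data: a set of positions with codes, and for every edge `e` of `X` a rule which matches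
the positions at the initial end of `e` with those at its terminal end. -/
structure Gluing (X : TwoComplex.{u}) where
  P : Type u
  code : P → X.Code
  valid : ∀ p, (code p).Valid
  next : X.G.E → Equiv.Perm P
  into_next : ∀ e p, (code (next e p)).into e = (code p).out e

namespace Gluing

variable (D : Gluing X)

theorem mem_next_iff (p : D.P) (ε : X.S.E) :
    X.S.τ ε ∈ (D.code (D.next (X.w.onE ε) p)).T ↔ X.S.ι ε ∈ (D.code p).T := by
  have h := congrArg (fun x => ε ∈ x.1) (D.into_next (X.w.onE ε) p)
  simpa [Code.into, Code.out] using h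

theorem r_next_iff (p : D.P) (ε ε' : X.S.E) :
    (D.code (D.next (X.w.onE ε) p)).r (Sum.inr ε) (Sum.inr ε') ↔
      (D.code p).r (Sum.inl ε) (Sum.inl ε') := by
  have h := congrArg (fun x => x.2 ε ε') (D.into_next (X.w.onE ε) p)
  simpa [Code.into, Code.out] using h

/-- The face boundaries of the glued complex. -/
def S : MGraph.{u} where
  V := {x : D.P × X.S.V // x.2 ∈ (D.code x.1).T}
  E := {x : D.P × X.S.E // X.S.ι x.2 ∈ (D.code x.1).T}
  ι x := ⟨(x.1.1, X.S.ι x.1.2), x.2⟩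
  τ x := ⟨(D.next (X.w.onE x.1.2) x.1.1, X.S.τ x.1.2), (D.mem_next_iff _ _).2 x.2⟩

/-- The projection of the face boundaries. -/
def projS : MGraph.Hom D.S X.S where
  onV x := x.1.2
  onE x := x.1.2
  map_ι _ := rfl
  map_τ _ := rfl

/-- The vertices of the glued 1-skeleton. -/
def setoidV : Setoid D.S.V where
  r x y := x.1.1 = y.1.1 ∧ (D.code x.1.1).q x.1.2 y.1.2
  iseqv :=
    { refl := fun x => ⟨rfl, (D.valid _).q_refl _ x.2⟩
      symm := fun {x y} h => ⟨h.1.symm, h.1 ▸ (D.valid _).q_symm _ _ h.2⟩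
      trans := fun {x y z} h h' =>
        ⟨h.1.trans h'.1, (D.valid _).q_trans _ _ _ h.2 (by rw [h.1]; exact h'.2)⟩ }

/-- The edges of the glued 1-skeleton. -/
def setoidE : Setoid D.S.E where
  r x y := x.1.1 = y.1.1 ∧ (D.code x.1.1).r (Sum.inl x.1.2) (Sum.inl y.1.2)
  iseqv :=
    { refl := fun x => ⟨rfl, (D.valid _).r_refl _ x.2⟩
      symm := fun {x y} h => ⟨h.1.symm, h.1 ▸ (D.valid _).r_symm _ _ h.2⟩
      trans := fun {x y z} h h' =>
        ⟨h.1.trans h'.1, (D.valid _).r_trans _ _ _ h.2 (by rw [h.1]; exact h'.2)⟩ }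

theorem onE_eq_of_setoidE {x y : D.S.E} (h : D.setoidE x y) :
    X.w.onE x.1.2 = X.w.onE y.1.2 :=
  Sum.inl_injective ((D.valid _).r_onHalf _ _ h.2)

/-- The 1-skeleton of the glued complex. -/
def G : MGraph.{u} where
  V := Quotient D.setoidV
  E := Quotient D.setoidE
  ι := Quotient.map D.S.ι fun _ _ h => ⟨h.1, (D.valid _).r_base _ _ h.2⟩
  τ := Quotient.map D.S.τ fun x y h => by
    refine ⟨?_, (D.valid _).r_base _ _ ((D.r_next_iff _ _ _).2 h.2)⟩
    change D.next _ _ = D.next _ _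
    rw [D.onE_eq_of_setoidE h, h.1]

/-- The attaching map of the glued complex. -/
def w : MGraph.Hom D.S D.G where
  onV := Quotient.mk _
  onE := Quotient.mk _
  map_ι _ := rfl
  map_τ _ := rfl

/-- An edge of `D.S` is labelled by its initial position. Edges over the same `ε` that end at the
same position also start at the same one, because `next` is injective. -/
theorem projS_isImmersion : D.projS.IsImmersion := by
  rintro ⟨⟨p, ε⟩, hx⟩ ⟨⟨p', ε'⟩, hx'⟩ h (rfl : ε = ε')
  have hp : p = p' := by
    rcases h with h | h
    · exact congrArg (fun x => x.1.1) h
    · exact (D.next _).injective (congrArg (fun x => x.1.1) h)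
  subst hp
  rfl

theorem isUnionOfCycles [Finite D.P] (hX : X.IsFinite) : D.S.IsUnionOfCycles := by
  have := hX.finite_SV
  refine ⟨fun v => ?_, fun v => ?_⟩
  · rw [← X.cycles.valence_eq_two (D.projS.onV v)]
    refine Nat.card_eq_of_bijective
      (fun h : D.S.Star v => (⟨D.projS.onHalf h.1, by rw [MGraph.Hom.base_onHalf, h.2]⟩ :
        X.S.Star (D.projS.onV v))) ⟨fun h h' e => ?_, ?_⟩
    · exact Subtype.ext
        (D.projS_isImmersion.half_inj (h.2.trans h'.2.symm) (congrArg Subtype.val e))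
    · obtain ⟨⟨p, s⟩, hs⟩ := v
      rintro ⟨ε | ε, hε⟩
      · have hε' : X.S.ι ε = s := hε
        exact ⟨⟨Sum.inl ⟨(p, ε), hε' ▸ hs⟩, Subtype.ext (Prod.ext rfl hε')⟩, rfl⟩
      · have hε' : X.S.τ ε = s := hε
        -- The edge entering at `p` is labelled by the preceding position, found by inverting
        -- `next`.
        obtain ⟨p, rfl⟩ := (D.next (X.w.onE ε)).surjective p
        exact ⟨⟨Sum.inr ⟨(p, ε), (D.mem_next_iff _ _).1 (hε' ▸ hs)⟩,
          Subtype.ext (Prod.ext rfl hε')⟩, rfl⟩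
  · have : Finite D.S.V := Subtype.finite
    exact Set.toFinite _

theorem w_isImmersion : D.w.IsImmersion := by
  rintro ⟨⟨p, ε⟩, hx⟩ ⟨⟨p', ε'⟩, hx'⟩ h he
  have he : D.setoidE ⟨(p, ε), hx⟩ ⟨(p', ε'), hx'⟩ := Quotient.exact he
  have hw := D.onE_eq_of_setoidE he
  obtain rfl : p = p' := he.1
  have hε : ε = ε' := X.w_immersion _ _
    (h.imp (fun h => congrArg (fun x => x.1.2) h) (fun h => congrArg (fun x => x.1.2) h)) hw
  subst hε
  rfl

/-- The glued complex. -/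
def complex [Finite D.P] (hX : X.IsFinite) : TwoComplex.{u} where
  G := D.G
  S := D.S
  w := D.w
  cycles := D.isUnionOfCycles hX
  w_immersion := D.w_isImmersion

variable [Finite D.P] (hX : X.IsFinite)

/-- The map from the glued complex. -/
def hom : Hom (D.complex hX) X where
  onG :=
    { onV := Quotient.lift (fun x : D.S.V => X.w.onV x.1.2)
        fun _ _ h => (D.valid _).q_onV _ _ h.2
      onE := Quotient.lift (fun x : D.S.E => X.w.onE x.1.2) fun _ _ h => D.onE_eq_of_setoidE h
      map_ι := by rintro ⟨x⟩; exact X.w.map_ι _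
      map_τ := by rintro ⟨x⟩; exact X.w.map_τ _ }
  onS := D.projS
  comm := rfl
  onS_immersion := D.projS_isImmersion

/-- The framing of the glued complex. -/
def framing : (D.hom hX).Framing D.P where
  pos x := x.1.1
  pos_surjective p := by
    obtain ⟨s, hs⟩ := (D.valid p).nonempty
    exact ⟨⟨(p, s), hs⟩, rfl⟩
  onV_surjective := Quotient.mk_surjective
  onE_surjective := Quotient.mk_surjective
  pos_eq_of_onV_eq h := (Quotient.exact h : D.setoidV _ _).1
  eq_of_pos_eq h h' := Subtype.ext (Prod.ext h h')
  pos_iff := by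
    rintro ⟨⟨p, ε⟩, hx⟩ ⟨⟨p', ε'⟩, hx'⟩ h
    change X.w.onE ε = X.w.onE ε' at h
    change p = p' ↔ D.next (X.w.onE ε) p = D.next (X.w.onE ε') p'
    rw [h, (D.next _).injective.eq_iff]

/-- At terminal halves the relation was not imposed directly: edges were identified by their initial
halves, and `r_next_iff` makes the two ends agree. -/
theorem framing_code (p : D.P) : (D.framing hX).code p = D.code p := by
  have hT : ((D.framing hX).code p).T = (D.code p).T := by
    ext s
    constructor
    · rintro ⟨⟨⟨_, _⟩, hx⟩, rfl, rfl⟩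
      exact hx
    · intro hs
      exact ⟨⟨(p, s), hs⟩, rfl, rfl⟩
  refine Code.ext hT ?_ ?_
  · ext s s'
    constructor
    · rintro ⟨⟨⟨_, _⟩, hx⟩, ⟨⟨_, _⟩, hx'⟩, rfl, h, rfl, rfl, hw⟩
      exact (Quotient.exact hw : D.setoidV _ _).2
    · intro h
      obtain ⟨hs, hs'⟩ := (D.valid p).q_mem _ _ h
      exact ⟨⟨(p, s), hs⟩, ⟨(p, s'), hs'⟩, rfl, rfl, rfl, rfl, Quotient.sound ⟨rfl, h⟩⟩
  · ext h h'
    constructor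
    · rintro ⟨⟨⟨p', ε⟩, hx⟩ | ⟨⟨p', ε⟩, hx⟩, ⟨⟨p'', ε'⟩, hx'⟩ | ⟨⟨p'', ε'⟩, hx'⟩, hp, hp', rfl,
        rfl, hw⟩
      · have hw : D.setoidE _ _ := Quotient.exact (Sum.inl_injective hw)
        obtain rfl : p' = p := hp
        exact hw.2
      · cases hw
      · cases hw
      · have hw : D.setoidE _ _ := Quotient.exact (Sum.inr_injective hw)
        obtain rfl : D.next (X.w.onE ε) p' = p := hp
        exact (D.r_next_iff _ _ _).2 hw.2
    · intro hr
      have hm := (D.valid p).q_mem _ _ ((D.valid p).r_base _ _ hr)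
      have hh := (D.valid p).r_onHalf _ _ hr
      rcases h with ε | ε <;> rcases h' with ε' | ε'
      · exact ⟨Sum.inl ⟨(p, ε), hm.1⟩, Sum.inl ⟨(p, ε'), hm.2⟩, rfl, rfl, rfl, rfl,
          congrArg Sum.inl (Quotient.sound ⟨rfl, hr⟩)⟩
      · cases hh
      · cases hh
      · have hh : X.w.onE ε = X.w.onE ε' := Sum.inr_injective hh
        obtain ⟨p, rfl⟩ := (D.next (X.w.onE ε)).surjective p
        refine ⟨Sum.inr ⟨(p, ε), (D.mem_next_iff _ _).1 hm.1⟩,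
          Sum.inr ⟨(p, ε'), (D.mem_next_iff _ _).1 (hh ▸ hm.2)⟩, rfl, ?_, rfl, rfl,
          congrArg Sum.inr (Quotient.sound ⟨rfl, (D.r_next_iff _ _ _).1 hr⟩)⟩
        change D.next (X.w.onE ε') p = _
        rw [hh]

theorem complex_isFinite : (D.complex hX).IsFinite := by
  have := hX.finite_SV
  have := hX.finite_SE
  have hV : Finite D.S.V := Subtype.finite
  have hE : Finite D.S.E := Subtype.finite
  exact ⟨Quotient.finite _, Quotient.finite _, hV, hE⟩

end Gluing

end TwoComplex

-- Dickson's lemma and maximal ratios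

/-- An additive ratio on a set of vectors of natural numbers that is closed under subtraction
attains its maximum: there are only finitely many minimal nonzero vectors. -/
theorem exists_max_ratio {ι : Type*} [Finite ι] (A : Set (ι → ℕ))
    (hA : ∀ n ∈ A, ∀ m ∈ A, m ≤ n → n - m ∈ A) (K D : (ι → ℕ) →+ ℤ)
    (hD : ∀ n ∈ A, n ≠ 0 → 0 < D n) (hne : ∃ n ∈ A, n ≠ 0) :
    ∃ m ∈ A, m ≠ 0 ∧ ∀ n ∈ A, n ≠ 0 → (K n : ℚ) / D n ≤ (K m : ℚ) / D m := by
  let B : Set (ι → ℕ) := {n | n ∈ A ∧ n ≠ 0}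
  -- Dickson's lemma: minimal vectors form an antichain, and `ι → ℕ` is well-quasi-ordered for
  -- finite `ι`.
  have hfin : {n | Minimal (· ∈ B) n}.Finite :=
    WellQuasiOrderedLE.finite_of_isAntichain (setOfPred_minimal_antichain _)
  have hmin : ∀ n ∈ B, ∃ m, m ≤ n ∧ Minimal (· ∈ B) m := fun n hn =>
    (Set.isPWO_of_wellQuasiOrderedLE B).exists_le_minimal hn
  obtain ⟨n₀, hn₀, hn₀'⟩ := hne
  obtain ⟨m₀, -, hm₀⟩ := hmin n₀ ⟨hn₀, hn₀'⟩
  obtain ⟨m, hm, hmax⟩ := Set.exists_max_image _ (fun n => (K n : ℚ) / D n) hfin ⟨m₀, hm₀⟩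
  refine ⟨m, hm.prop.1, hm.prop.2, ?_⟩
  -- Induction on a bound for `D n`: splitting off a minimal vector `a` lowers it, since `D a` is
  -- positive. The bound is linear in `n`, so it adds up.
  have key : ∀ N : ℕ, ∀ n ∈ A, n ≠ 0 → D n ≤ N → (K n : ℚ) ≤ (K m : ℚ) / D m * D n := by
    intro N
    induction N with
    | zero => intro n hn hn' h; have := hD n hn hn'; omega
    | succ N ih =>
      intro n hn hn' h
      obtain ⟨a, han, ha⟩ := hmin n ⟨hn, hn'⟩
      have hDa := hD a ha.prop.1 ha.prop.2
      have h1 : (K a : ℚ) ≤ (K m : ℚ) / D m * D a :=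
        (div_le_iff₀ (by exact_mod_cast hDa)).1 (hmax a ha)
      have hsum : n = a + (n - a) := (add_tsub_cancel_of_le han).symm
      have hDs : D n = D a + D (n - a) := by rw [← map_add, ← hsum]
      have hKs : K n = K a + K (n - a) := by rw [← map_add, ← hsum]
      have h2 : (K (n - a) : ℚ) ≤ (K m : ℚ) / D m * D (n - a) := by
        by_cases h0 : n - a = 0
        · simp [h0]
        · exact ih _ (hA n hn a ha.prop.1 han) h0 (by push_cast at h; omega)
      rw [hDs, hKs]
      push_cast
      rw [mul_add]
      exact add_le_add h1 h2
  intro n hn hn'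
  rw [div_le_iff₀ (by exact_mod_cast hD n hn hn')]
  exact key (D n).toNat n hn hn' (Int.self_le_toNat _)

theorem Fintype.sum_comp_eq_sum_card_mul {P C R : Type*} [Fintype P] [Fintype C] [CommSemiring R]
    (c : P → C) (K : C → R) :
    ∑ p, K (c p) = ∑ t, (Nat.card {p // c p = t} : R) * K t := by
  classical
  rw [← Finset.sum_fiberwise Finset.univ c]
  refine Finset.sum_congr rfl fun t _ => ?_
  rw [Finset.sum_congr rfl (g := fun _ => K t) (fun p hp => by rw [(Finset.mem_filter.1 hp).2]),
    Finset.sum_const, nsmul_eq_mul, Nat.card_eq_fintype_card, Fintype.card_subtype]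

theorem Nat.card_fiber_comp {P C Z : Type*} [Fintype P] [Fintype C] [DecidableEq Z]
    (c : P → C) (g : C → Z) (z : Z) :
    Nat.card {p // g (c p) = z} = ∑ t, Nat.card {p // c p = t} * if g t = z then 1 else 0 := by
  have h := Fintype.sum_comp_eq_sum_card_mul c (fun t => if g t = z then 1 else 0 : C → ℕ)
  simp only [Nat.cast_id] at h
  rw [← h, Nat.card_eq_fintype_card, Fintype.card_subtype, Finset.card_filter]

/-- Two maps whose fibers have the same cardinalities differ by a permutation. -/
theorem Equiv.Perm.exists_comp_eq_of_card_fiber_eq {P Z : Type*} [Finite P] (a b : P → Z)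
    (h : ∀ z, Nat.card {p // a p = z} = Nat.card {p // b p = z}) :
    ∃ φ : Equiv.Perm P, ∀ p, b (φ p) = a p :=
  have g := fun z => (Finite.card_eq.1 (h z)).some
  ⟨(Equiv.sigmaFiberEquiv a).symm.trans
    ((Equiv.sigmaCongrRight g).trans (Equiv.sigmaFiberEquiv b)), fun p => (g (a p) ⟨p, rfl⟩).2⟩

-- The gluing equations and their solutions

namespace TwoComplex

open scoped Classical in
/-- The vectors that count the codes in framed visibly irreducible complexes over `X`, described by
the gluing equations. -/
def codeVectors (X : TwoComplex.{u}) [Fintype X.Code] : Set (X.Code → ℕ) :=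
  {n | (∀ t, n t ≠ 0 → t.Occurs) ∧ ∀ e z,
    ∑ t, n t * (if t.out e = z then 1 else 0) = ∑ t, n t * (if t.into e = z then 1 else 0)}

/-- The additive extension of a function of codes to vectors. -/
def Code.sumHom {X : TwoComplex.{u}} [Fintype X.Code] (K : X.Code → ℤ) : (X.Code → ℕ) →+ ℤ where
  toFun n := ∑ t, n t * K t
  map_zero' := by simp
  map_add' m n := by simp [add_mul, Finset.sum_add_distrib]

/-- The contribution of a position to the total curvature. -/
noncomputable def Code.curvature {X : TwoComplex.{u}} (t : X.Code) : ℤ :=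
  (t.deg : ℤ) + t.numV - t.numE

variable {X Y : TwoComplex.{u}}

theorem sub_mem_codeVectors [Fintype X.Code] {n m : X.Code → ℕ} (hn : n ∈ X.codeVectors) (hm : m ∈ X.codeVectors)
    (h : m ≤ n) : n - m ∈ X.codeVectors := by
  classical
  refine ⟨fun t ht => hn.1 t fun h0 => ht (by simp [h0]), fun e z => ?_⟩
  have hs : ∀ c : X.Code → ℕ, ∑ t, n t * c t = ∑ t, m t * c t + ∑ t, (n - m) t * c t := by
    intro c
    rw [← Finset.sum_add_distrib]
    refine Finset.sum_congr rfl fun t _ => ?_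
    rw [← add_mul, Pi.sub_apply, Nat.add_sub_cancel' (h t)]
  have h1 := hn.2 e z
  have h2 := hm.2 e z
  rw [hs, hs (fun t => if t.into e = z then 1 else 0)] at h1
  omega

namespace Hom.Framing

variable {f : Hom Y X} {P : Type u} (F : f.Framing P)

/-- The vector that counts the positions with each code. -/
noncomputable def codeCount (t : X.Code) : ℕ := Nat.card {p // F.code p = t}

theorem codeCount_mem [Fintype X.Code] [Finite P] (hY : Y.VisiblyIrreducible) : F.codeCount ∈ X.codeVectors := by
  classical
  have := Fintype.ofFinite P
  refine ⟨fun t ht => ?_, fun e z => ?_⟩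
  · have := (Nat.card_ne_zero.1 ht).1
    obtain ⟨p, hp⟩ := this
    exact ⟨Y, f, P, F, p, hY, hp⟩
  · obtain ⟨φ, hφ⟩ := F.exists_perm e
    have h1 := Nat.card_fiber_comp F.code (fun t => t.out e) z
    have h2 := Nat.card_fiber_comp F.code (fun t => t.into e) z
    unfold codeCount
    convert (h1.symm.trans ?_).trans h2
    exact Nat.card_congr (φ.subtypeEquiv fun p => by rw [hφ])

theorem deg_eq_sumHom [Fintype X.Code] [Finite P] [Finite Y.S.V] :
    (f.deg : ℤ) = Code.sumHom (fun t => (t.deg : ℤ)) F.codeCount := by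
  have := Fintype.ofFinite P
  rw [F.deg_eq_sum, Nat.cast_sum]
  exact Fintype.sum_comp_eq_sum_card_mul F.code (fun t => (t.deg : ℤ))

theorem totalCurvature_eq_sumHom [Fintype X.Code] [Finite P] (hY : Y.IsFinite) :
    f.totalCurvature = Code.sumHom Code.curvature F.codeCount := by
  have := Fintype.ofFinite P
  rw [F.totalCurvature_eq_sum hY]
  exact Fintype.sum_comp_eq_sum_card_mul F.code Code.curvature

theorem codeCount_ne_zero [Finite P] [hP : Nonempty P] : F.codeCount ≠ 0 := by
  obtain ⟨p⟩ := hP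
  intro h
  have h1 := congrFun h (F.code p)
  have : Nonempty {p' // F.code p' = F.code p} := ⟨⟨p, rfl⟩⟩
  exact Nat.card_pos.ne' h1

end Hom.Framing

/-- Every nonzero solution of the gluing equations is realized. -/
theorem exists_framing_of_mem_codeVectors [Fintype X.Code] (hX : X.IsFinite) {n : X.Code → ℕ}
    (hn : n ∈ X.codeVectors) (hn0 : n ≠ 0) :
    ∃ (Y : TwoComplex.{u}) (f : Hom Y X) (P : Type u) (F : f.Framing P), Nonempty P ∧ Finite P ∧
      Y.IsFinite ∧ Y.VisiblyIrreducible ∧ F.codeCount = n := by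
  classical
  -- The positions are `n t` copies of each code `t`. The gluing equations say that, for each `e`,
  -- outgoing and incoming data occur equally often, which provides the permutations `next e`.
  let P := Σ t : X.Code, Fin (n t)
  have hcount : ∀ t, Nat.card {p : P // p.1 = t} = n t := fun t =>
    (Nat.card_congr (Equiv.sigmaSubtype t)).trans (Nat.card_fin _)
  have hocc : ∀ p : P, p.1.Occurs := fun p => hn.1 p.1 fun h0 => (Fin.cast h0 p.2).elim0
  have hperm : ∀ e, ∃ φ : Equiv.Perm P, ∀ p, (φ p).1.into e = p.1.out e := by
    intro e
    refine Equiv.Perm.exists_comp_eq_of_card_fiber_eq (fun p : P => p.1.out e)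
      (fun p : P => p.1.into e) fun z => ?_
    rw [Nat.card_fiber_comp (fun p : P => p.1) (fun t => t.out e) z,
      Nat.card_fiber_comp (fun p : P => p.1) (fun t => t.into e) z]
    simp only [hcount]
    convert hn.2 e z
  choose φ hφ using hperm
  let D : Gluing X :=
    { P := P
      code := fun p => p.1
      valid := fun p => by
        obtain ⟨Y', f', P', F', p', -, h⟩ := hocc p
        exact h ▸ F'.code_valid p'
      next := φ
      into_next := hφ }
  have hDP : Finite D.P := inferInstanceAs (Finite P)
  have hcode : ∀ p : P, (D.framing hX).code p = p.1 := D.framing_code hX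
  obtain ⟨t, ht⟩ := Function.ne_iff.1 hn0
  refine ⟨D.complex hX, D.hom hX, D.P, D.framing hX, ⟨⟨t, ⟨0, Nat.pos_of_ne_zero ht⟩⟩⟩, hDP,
    D.complex_isFinite hX,
    (D.framing hX).visiblyIrreducible_of_occurs fun p => hcode p ▸ hocc p, ?_⟩
  funext t
  rw [← hcount t]
  exact Nat.card_congr (Equiv.subtypeEquivRight fun p => by rw [hcode p])

end TwoComplex

-- Attaining the supremum

theorem mainTheorem4 (X : TwoComplex.{u}) (hX : X.IsFinite)
    (hne : ∃ (Y : TwoComplex.{u}) (f : TwoComplex.Hom Y X),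
      Nonempty Y.G.V ∧ Y.IsFinite ∧ Y.VisiblyIrreducible ∧ f.IsFaceEssential) :
    ∃ (Ymax : TwoComplex.{u}) (fmax : TwoComplex.Hom Ymax X),
      Nonempty Ymax.G.V ∧ Ymax.IsFinite ∧ Ymax.VisiblyIrreducible ∧ fmax.IsFaceEssential ∧
      0 < fmax.deg ∧
      ∀ (Y : TwoComplex.{u}) (f : TwoComplex.Hom Y X),
        Nonempty Y.G.V → Y.IsFinite → Y.VisiblyIrreducible → f.IsFaceEssential →
          0 < f.deg ∧
          (f.totalCurvature : ℚ) / (f.deg : ℚ) ≤ (fmax.totalCurvature : ℚ) / (fmax.deg : ℚ) := by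
  have := TwoComplex.Code.finite hX
  have := Fintype.ofFinite X.Code
  have degPos : ∀ {Y : TwoComplex.{u}} {f : TwoComplex.Hom Y X} {P : Type u} (F : f.Framing P)
      [Nonempty P], Y.IsFinite → 0 < f.deg := by
    intro Y f P F hP hY
    have := hY.finite_SV
    obtain ⟨u, -⟩ := F.pos_surjective (Classical.arbitrary P)
    have : Nonempty Y.S.V := ⟨u⟩
    exact f.deg_pos
  have framed : ∀ {Y : TwoComplex.{u}} {f : TwoComplex.Hom Y X}, Nonempty Y.G.V → Y.IsFinite →
      Y.VisiblyIrreducible → f.IsFaceEssential →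
      ∃ (P : Type u) (_ : f.Framing P), Nonempty P ∧ Finite P := by
    intro Y f hV hY hYi hf
    have := hY.finite_V
    exact ⟨_, hf.framing hYi, hV.map (Quotient.mk _), Quotient.finite _⟩
  obtain ⟨m, hm, hm0, hmax⟩ := exists_max_ratio X.codeVectors
    (fun n hn m hm => TwoComplex.sub_mem_codeVectors hn hm)
    (TwoComplex.Code.sumHom TwoComplex.Code.curvature)
    (TwoComplex.Code.sumHom fun t => (t.deg : ℤ))
    -- The degree functional is positive on nonzero solutions because each is realized by a complex
    -- with at least one face.
    (fun n hn hn0 => by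
      obtain ⟨Y, f, P, F, hP, hPf, hY, -, rfl⟩ :=
        TwoComplex.exists_framing_of_mem_codeVectors hX hn hn0
      have := hY.finite_SV
      rw [← F.deg_eq_sumHom]
      exact_mod_cast degPos F hY)
    (by
      obtain ⟨Y, f, hV, hY, hYi, hf⟩ := hne
      obtain ⟨P, F, hP, hPf⟩ := framed hV hY hYi hf
      exact ⟨F.codeCount, F.codeCount_mem hYi, F.codeCount_ne_zero⟩)
  obtain ⟨Y₀, f₀, P₀, F₀, hP₀, hPf₀, hY₀, hYi₀, rfl⟩ :=
    TwoComplex.exists_framing_of_mem_codeVectors hX hm hm0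
  have hS₀ := hY₀.finite_SV
  obtain ⟨u₀, -⟩ := F₀.pos_surjective (Classical.arbitrary P₀)
  refine ⟨Y₀, f₀, ⟨Y₀.w.onV u₀⟩, hY₀, hYi₀, F₀.isFaceEssential, degPos F₀ hY₀, ?_⟩
  intro Y f hV hY hYi hf
  obtain ⟨P, F, hP, hPf⟩ := framed hV hY hYi hf
  have hS := hY.finite_SV
  refine ⟨degPos F hY, ?_⟩
  have h := hmax F.codeCount (F.codeCount_mem hYi) F.codeCount_ne_zero
  rw [← F.deg_eq_sumHom, ← F₀.deg_eq_sumHom, ← F.totalCurvature_eq_sumHom hY,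
    ← F₀.totalCurvature_eq_sumHom hY₀] at h
  exact_mod_cast h
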